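/- Let $L>0$, $\alpha\in(0,2)$, $\beta\in(0,1)$. For an integer $N\ge 1$, points $X=(x_0,\dots,x_N)\in(\mathbb R^3)^{N+1}$ with $x_i\ne x_{i-1}$ for $i=1,\dots,N$, and angles $\Phi=(\varphi_1,\dots,\varphi_N)\in\mathbb R^N$, put $$\ell(X)=\sum_{i=1}^N|x_i-x_{i-1}|,\qquad \lambda(X)=\frac{\ell(X)}{L},\qquad \tau_i=\sum_{k=1}^i|x_k-x_{k-1}|-\tfrac12|x_i-x_{i-1}|,$$ $$\overline{x_i}=\tfrac12(x_{i-1}+x_i),\qquad e_i=\frac{x_i-x_{i-1}}{|x_i-x_{i-1}|}\qquad(i=1,\dots,N).$$ Let $\eta^X:[0,\ell(X)]\to\mathbb R^3$ be given by $\eta^X(\tau)=x_0+\tau e_1$ for $\tau\le\tau_1$, by $\eta^X(\tau)=x_N-(\ell(X)-\tau)e_N$ for $\tau\ge\tau_N$, and by $\eta^X(\tau)=S_i(\tau-\tau_i)$ for $\tau_i\le\tau\le\tau_{i+1}$, $1\le i\le N-1$, where $S_i$ is the unique polynomial of degree at most $3$ with $$S_i(0)=\overline{x_i},\quad S_i(\tau_{i+1}-\tau_i)=\overline{x_{i+1}},\quad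 S_i'(0)=e_i,\quad S_i'(\tau_{i+1}-\tau_i)=e_{i+1}.$$ Let $\zeta^{X,\Phi}:[0,\ell(X)]\to\mathbb R$ be the continuous function that equals $\varphi_1$ for $\tau\le\tau_1$, equals $\varphi_N$ for $\tau\ge\tau_N$, and is affine on each $[\tau_i,\tau_{i+1}]$ with $\zeta^{X,\Phi}(\tau_i)=\varphi_i$. For $t\in[0,L]$ set $y^X(t)=\eta^X(\lambda(X)t)$ and $z^{X,\Phi}(t)=\zeta^{X,\Phi}(\lambda(X)t)$, and define $$\mathcal F_N^{\rm disc}(X,\Phi)=\int_0^L|(y^X)''|^2\,dt+\int_0^L|(z^{X,\Phi})'|^2\,dt+N^\alpha|\lambda(X)-1|+N^\beta\max_{1\le i\le N}|x_i-x_{i-1}|.$$ For $(y,z)\in L^2((0,L);\mathbb R^3)\times L^2(0,L)$ let $$\mathcal F_N(y,z)=\inf\bigl\{\mathcal F_N^{\rm disc}(X,\Phi): y=y^X,\ z=z^{X,\Phi}\ \text{a.e. in }(0,L)\bigr\}\in[0,\infty],\qquad \inf\emptyset=\infty,$$ where the infimum runs over all $(X,\Phi)$ as above, and let $$\mathcal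 F(u,\theta)=\int_0^L|u''|^2+|\theta'|^2\,ds$$ if $u\in W^{2,2}((0,L);\mathbb R^3)$, $\theta\in W^{1,2}(0,L)$ and $|u'|=1$ a.e. in $(0,L)$, and $\mathcal F(u,\theta)=\infty$ otherwise. **Theorem ($\Gamma$-convergence).** As $N\to\infty$, $\mathcal F_N$ $\Gamma$-converges to $\mathcal F$ on $L^2((0,L);\mathbb R^3)\times L^2(0,L)$ with respect to the norm topology. That is, for every $(u,\theta)$ in this space: 1. $\mathcal F(u,\theta)\le\liminf_{N\to\infty}\mathcal F_N(y_N,z_N)$ for every sequence $(y_N,z_N)\to(u,\theta)$; 2. there is a sequence $(y_N,z_N)\to(u,\theta)$ with $\lim_{N\to\infty}\mathcal F_N(y_N,z_N)=\mathcal F(u,\theta)$. -/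

import Mathlib

open MeasureTheory Filter Topology
open scoped ENNReal ContDiff

noncomputable section

namespace KirchhoffRod

/-- Euclidean three-space. -/
abbrev E3 : Type := EuclideanSpace ℝ (Fin 3)

/-! ### Gamma-convergence -/

/-- Gamma-convergence of extended nonnegative functionals on a metric space, in its sequential form:
the liminf inequality along every convergent sequence, and existence of recovery sequences. -/
structure GammaConverges {Z : Type*} [PseudoMetricSpace Z] (F : ℕ → Z → ℝ≥0∞) (G : Z → ℝ≥0∞) :
    Prop where
  liminf_ineq : ∀ (p : Z) (q : ℕ → Z), Tendsto q atTop (𝓝 p) →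
    G p ≤ liminf (fun N => F N (q N)) atTop
  recovery : ∀ p : Z, ∃ q : ℕ → Z, Tendsto q atTop (𝓝 p) ∧
    Tendsto (fun N => F N (q N)) atTop (𝓝 (G p))

/-! ### Sobolev functions on the interval `(0, L)` -/

/-- `L²((0, L); E)`. -/
abbrev L2 (L : ℝ) (E : Type*) [NormedAddCommGroup E] : Type _ :=
  Lp E 2 (volume.restrict (Set.Ioo (0 : ℝ) L))

/-- `g` is a weak derivative of `f` on `(0, L)`. -/
def HasWeakDeriv {E : Type*} [NormedAddCommGroup E] [NormedSpace ℝ E] (L : ℝ) (f g : ℝ → E) :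
    Prop :=
  ∀ φ : ℝ → ℝ, ContDiff ℝ ∞ φ → HasCompactSupport φ → tsupport φ ⊆ Set.Ioo (0 : ℝ) L →
    ∫ t in Set.Ioo (0 : ℝ) L, deriv φ t • f t = -∫ t in Set.Ioo (0 : ℝ) L, φ t • g t

section

variable {E : Type*} [NormedAddCommGroup E] [NormedSpace ℝ E] {L : ℝ}

/-- `f ∈ W^{1,2}((0, L); E)`. -/
def IsW12 (f : L2 L E) : Prop := ∃ g : L2 L E, HasWeakDeriv L f g

open Classical in
/-- The weak derivative of a `W^{1,2}` function (and `0` for any other function). -/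
def weakDeriv (f : L2 L E) : L2 L E := if h : IsW12 f then h.choose else 0

/-- `f ∈ W^{2,2}((0, L); E)`. -/
def IsW22 (f : L2 L E) : Prop := IsW12 f ∧ IsW12 (weakDeriv f)

end

open Classical in
/-- The continuum energy `∫₀ᴸ |u''|² + |θ'|²`, finite only for `u ∈ W^{2,2}` parametrized by
arc length and `θ ∈ W^{1,2}`. -/
def kirchhoffEnergy (L : ℝ) (p : L2 L E3 × L2 L ℝ) : ℝ≥0∞ :=
  if IsW22 p.1 ∧ IsW12 p.2 ∧
      ∀ᵐ t ∂(volume.restrict (Set.Ioo (0 : ℝ) L)), ‖weakDeriv p.1 t‖ = 1 then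
    ∫⁻ t in Set.Ioo (0 : ℝ) L,
      (‖weakDeriv (weakDeriv p.1) t‖ₑ ^ 2 + ‖weakDeriv p.2 t‖ₑ ^ 2)
  else ⊤

/-! ### Framed discrete rods

A framed discrete rod with `N` edges is a pair `X = (x_0, …, x_N)`, `Φ = (φ_1, …, φ_N)`. -/

section

variable {N : ℕ}

/-- `x_i`, for `0 ≤ i ≤ N`. -/
def vertex (X : Fin (N + 1) → E3) (i : ℕ) : E3 := if h : i < N + 1 then X ⟨i, h⟩ else 0

/-- `φ_i`, for `1 ≤ i ≤ N`. -/
def angle (Φ : Fin N → ℝ) (i : ℕ) : ℝ := if h : i - 1 < N then Φ ⟨i - 1, h⟩ else 0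

/-- `|x_i - x_{i-1}|`, for `1 ≤ i ≤ N`. -/
def edgeLength (X : Fin (N + 1) → E3) (i : ℕ) : ℝ := ‖vertex X i - vertex X (i - 1)‖

/-- The unit vector `(x_i - x_{i-1}) / |x_i - x_{i-1}|`, for `1 ≤ i ≤ N`. -/
def edgeDir (X : Fin (N + 1) → E3) (i : ℕ) : E3 :=
  (edgeLength X i)⁻¹ • (vertex X i - vertex X (i - 1))

/-- The midpoint `(x_{i-1} + x_i) / 2`, for `1 ≤ i ≤ N`. -/
def edgeMid (X : Fin (N + 1) → E3) (i : ℕ) : E3 :=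
  (1 / 2 : ℝ) • (vertex X (i - 1) + vertex X i)

/-- The length `ℓ(X)` of the polygonal line. -/
def polyLength (X : Fin (N + 1) → E3) : ℝ := ∑ i ∈ Finset.Icc 1 N, edgeLength X i

/-- `λ(X) = ℓ(X) / L`. -/
def stretch (L : ℝ) (X : Fin (N + 1) → E3) : ℝ := polyLength X / L

/-- The knot `τ_i`, for `1 ≤ i ≤ N`: the arc length along the polygon up to the midpoint of the
`i`-th edge. -/
def knot (X : Fin (N + 1) → E3) (i : ℕ) : ℝ :=
  (∑ k ∈ Finset.Icc 1 i, edgeLength X k) - edgeLength X i / 2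

/-- The cubic polynomial `S` with `S 0 = a`, `S T = b`, `S' 0 = v`, `S' T = w` (for `T ≠ 0`). -/
def hermite (T : ℝ) (a b v w : E3) (s : ℝ) : E3 :=
  a + s • v + s ^ 2 • ((3 / T ^ 2) • (b - a) - (1 / T) • ((2 : ℝ) • v + w))
    + s ^ 3 • ((1 / T ^ 2) • (v + w) - (2 / T ^ 3) • (b - a))

theorem hermite_zero (T : ℝ) (a b v w : E3) : hermite T a b v w 0 = a := by
  simp [hermite]

theorem hermite_end {T : ℝ} (hT : T ≠ 0) (a b v w : E3) : hermite T a b v w T = b := by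
  ext i
  simp [hermite]
  field_simp
  ring

theorem hasDerivAt_hermite (T : ℝ) (a b v w : E3) (s : ℝ) :
    HasDerivAt (hermite T a b v w)
      (v + (2 * s) • ((3 / T ^ 2) • (b - a) - (1 / T) • ((2 : ℝ) • v + w))
        + (3 * s ^ 2) • ((1 / T ^ 2) • (v + w) - (2 / T ^ 3) • (b - a))) s := by
  have h := (((hasDerivAt_const s a).add ((hasDerivAt_id s).smul_const v)).add
    (((hasDerivAt_id s).pow 2).smul_const
      ((3 / T ^ 2) • (b - a) - (1 / T) • ((2 : ℝ) • v + w)))).add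
    (((hasDerivAt_id s).pow 3).smul_const ((1 / T ^ 2) • (v + w) - (2 / T ^ 3) • (b - a)))
  refine HasDerivAt.congr_deriv (f := hermite T a b v w) h ?_
  simp

theorem deriv_hermite_zero (T : ℝ) (a b v w : E3) : deriv (hermite T a b v w) 0 = v := by
  rw [(hasDerivAt_hermite T a b v w 0).deriv]
  simp

theorem deriv_hermite_end {T : ℝ} (hT : T ≠ 0) (a b v w : E3) :
    deriv (hermite T a b v w) T = w := by
  rw [(hasDerivAt_hermite T a b v w T).deriv]
  ext i
  simp
  field_simp
  ring

/-- The spline `η^X`: straight before `τ_1` and after `τ_N`, and on `[τ_i, τ_{i+1}]` the cubic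
Hermite interpolation between the midpoints of two consecutive edges with unit tangents. In the sum
exactly one term is nonzero. -/
def splineCurve (X : Fin (N + 1) → E3) (τ : ℝ) : E3 :=
  if τ ≤ knot X 1 then vertex X 0 + τ • edgeDir X 1
  else if knot X N ≤ τ then vertex X N - (polyLength X - τ) • edgeDir X N
  else ∑ i ∈ Finset.Ico 1 N, (Set.Ico (knot X i) (knot X (i + 1))).indicator
    (fun s => hermite (knot X (i + 1) - knot X i) (edgeMid X i) (edgeMid X (i + 1))
      (edgeDir X i) (edgeDir X (i + 1)) (s - knot X i)) τ

/-- The piecewise affine angle function `ζ^{X,Φ}`, with value `φ_i` at `τ_i`. -/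
def splineAngle (X : Fin (N + 1) → E3) (Φ : Fin N → ℝ) (τ : ℝ) : ℝ :=
  if τ ≤ knot X 1 then angle Φ 1
  else if knot X N ≤ τ then angle Φ N
  else ∑ i ∈ Finset.Ico 1 N, (Set.Ico (knot X i) (knot X (i + 1))).indicator
    (fun s => angle Φ i +
      (angle Φ (i + 1) - angle Φ i) / (knot X (i + 1) - knot X i) * (s - knot X i)) τ

/-- `y^X(t) = η^X(λ(X) t)`. -/
def rodCurve (L : ℝ) (X : Fin (N + 1) → E3) (t : ℝ) : E3 := splineCurve X (stretch L X * t)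

/-- `z^{X,Φ}(t) = ζ^{X,Φ}(λ(X) t)`. -/
def rodAngle (L : ℝ) (X : Fin (N + 1) → E3) (Φ : Fin N → ℝ) (t : ℝ) : ℝ :=
  splineAngle X Φ (stretch L X * t)

/-- Bending energy of the spline (which is `C¹` and twice differentiable off finitely many
points). -/
def bendEnergy (L : ℝ) (X : Fin (N + 1) → E3) : ℝ≥0∞ :=
  ∫⁻ t in Set.Ioo (0 : ℝ) L, ‖deriv (deriv (rodCurve L X)) t‖ₑ ^ 2

/-- Torsion energy of the angle function (which is differentiable off finitely many points). -/
def torEnergy (L : ℝ) (X : Fin (N + 1) → E3) (Φ : Fin N → ℝ) : ℝ≥0∞ :=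
  ∫⁻ t in Set.Ioo (0 : ℝ) L, ‖deriv (rodAngle L X Φ) t‖ₑ ^ 2

/-- The penalty `N^α |λ(X) - 1| + N^β max_i |x_i - x_{i-1}|`. -/
def penalty (L α β : ℝ) (X : Fin (N + 1) → E3) : ℝ :=
  (N : ℝ) ^ α * |stretch L X - 1| + (N : ℝ) ^ β * ⨆ i : Fin N, edgeLength X (i + 1)

/-- The energy of a framed discrete rod. -/
def rodEnergy (L α β : ℝ) (X : Fin (N + 1) → E3) (Φ : Fin N → ℝ) : ℝ≥0∞ :=
  bendEnergy L X + torEnergy L X Φ + ENNReal.ofReal (penalty L α β X)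

/-- The rod has at least one edge and consecutive vertices are distinct, so that the unit tangents
and the spline make sense. -/
def IsRod (X : Fin (N + 1) → E3) : Prop :=
  0 < N ∧ ∀ i ∈ Finset.Icc 1 N, vertex X i ≠ vertex X (i - 1)

/-- `(X, Φ)` is a framed discrete rod whose spline and angle function represent `p`. -/
def Represents (L : ℝ) (X : Fin (N + 1) → E3) (Φ : Fin N → ℝ) (p : L2 L E3 × L2 L ℝ) : Prop :=
  IsRod X ∧ p.1 =ᵐ[volume.restrict (Set.Ioo (0 : ℝ) L)] rodCurve L X ∧
    p.2 =ᵐ[volume.restrict (Set.Ioo (0 : ℝ) L)] rodAngle L X Φ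

end

/-- The discrete energy on `L²((0, L); ℝ³) × L²(0, L)`: the least energy of the framed discrete rods
with `N` edges that represent the given pair, and `∞` if there is none. (Different rods can have the
same spline, for instance when all vertices lie on a line.) -/
def discreteEnergy (L α β : ℝ) (N : ℕ) (p : L2 L E3 × L2 L ℝ) : ℝ≥0∞ :=
  ⨅ (X : Fin (N + 1) → E3) (Φ : Fin N → ℝ) (_ : Represents L X Φ p), rodEnergy L α β X Φ

end KirchhoffRod

end

/-! The lower bound is a compactness argument, the upper bound an explicit construction. Both rest
on two facts about the spline. At the knots its velocity is exactly `stretch • edgeDir`, of norm λ.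
Between knots its second derivative in arc length is a scalar multiple of the jump of the tangent,
with scalar 1/T (T the knot spacing) up to a relative error controlled by the ratio of neighbouring
edge lengths.

Lower bound. Along a subsequence with energies below c, the penalty forces λ → 1 and the longest
edge m → 0; this uses only α, β > 0. Velocities are Hölder-1/2 with constant √c and every parameter
is within m/λ of a knot, so the speed is uniformly close to λ. Velocities, accelerations and angle
slopes are then bounded in L², weak limits along an ultrafilter are the weak derivatives of the
limit pair, and weak lower semicontinuity of the norm bounds its energy by c. The constraint |u'| =
1 does not survive weak convergence of velocities. It is read off from chords instead: | |y(t) -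
y(s)| - λ(t - s) | is at most (t - s)(√(t-s) + √(m/λ))√c (`abs_dist_rodCurve_sub_le`). This passes
to a.e. limits of the curves, and differentiation gives unit speed (`HasWeakDeriv.ae_norm_eq_one`).
No strong convergence of velocities is needed.

Upper bound. A finite-energy pair has a unit-speed representative U with velocity V and acceleration
a. Take x_i = U(ih) with h = L/N, and for φ_i the averages of the angle over the cells. Edge vectors
are h times cell averages of V. Each edge is at most h and falls short of it by at most h²/2 times
the integral of |a|² over its cell, so λ - 1 = O(N⁻²) and the penalty vanishes exactly because α < 2
and β < 1. Squared differences of consecutive cell averages sum to at most h‖a‖², with sharp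
constant 1 (`sum_sq_norm_sub_average_le`), and normalising averages of norm close to 1 costs a
factor tending to 1. Hence the discrete energies have limsup at most the continuum energy, with no
smoothing or density argument. The lower bound supplies the rest. -/

namespace KirchhoffRod

/-! ### Test functions and weak derivatives on an interval. -/

/-- Smooth functions with compact support in `(0, L)`. -/
structure IsTest (L : ℝ) (φ : ℝ → ℝ) : Prop where
  contDiff : ContDiff ℝ ∞ φ
  compact : HasCompactSupport φ
  subset : tsupport φ ⊆ Set.Ioo (0 : ℝ) L

namespace IsTest

variable {L : ℝ} {φ ψ : ℝ → ℝ}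

theorem continuous (h : IsTest L φ) : Continuous φ := h.contDiff.continuous

theorem hasDerivAt (h : IsTest L φ) (t : ℝ) : HasDerivAt φ (deriv φ t) t :=
  (h.contDiff.differentiable (by simp) t).hasDerivAt

theorem eq_zero (h : IsTest L φ) {t : ℝ} (ht : t ∉ Set.Ioo (0 : ℝ) L) : φ t = 0 :=
  image_eq_zero_of_notMem_tsupport fun h' => ht (h.subset h')

protected theorem deriv (h : IsTest L φ) : IsTest L (deriv φ) where
  contDiff := ((contDiff_infty_iff_deriv (𝕜 := ℝ)).1 h.contDiff).2
  compact := h.compact.deriv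
  subset := tsupport_deriv_subset.trans h.subset

theorem sub (h : IsTest L φ) (h' : IsTest L ψ) : IsTest L (fun t => φ t - ψ t) where
  contDiff := h.contDiff.sub h'.contDiff
  compact := h.compact.sub h'.compact
  subset := (tsupport_sub φ ψ).trans (Set.union_subset h.subset h'.subset)

theorem const_mul (h : IsTest L φ) (c : ℝ) : IsTest L (fun t => c * φ t) where
  contDiff := contDiff_const.mul h.contDiff
  compact := h.compact.mul_left
  subset := (tsupport_mul_subset_right (f := fun _ => c) (g := φ)).trans h.subset

theorem exists_bound (h : IsTest L φ) : ∃ C, ∀ t, ‖φ t‖ ≤ C :=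
  h.continuous.bounded_above_of_compact_support h.compact

theorem integrable_smul {E : Type*} [NormedAddCommGroup E] [NormedSpace ℝ E] (h : IsTest L φ)
    {μ : Measure ℝ} {g : ℝ → E} (hg : Integrable g μ) : Integrable (fun t => φ t • g t) μ := by
  obtain ⟨C, hC⟩ := h.exists_bound
  exact hg.bdd_smul C h.continuous.aestronglyMeasurable (ae_of_all _ hC)

end IsTest

section Weak

variable {E : Type*} [NormedAddCommGroup E] [NormedSpace ℝ E] {L : ℝ}

theorem HasWeakDeriv.eq {f g : ℝ → E} (h : HasWeakDeriv L f g) {φ : ℝ → ℝ} (hφ : IsTest L φ) :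
    ∫ t in Set.Ioo (0 : ℝ) L, deriv φ t • f t = -∫ t in Set.Ioo (0 : ℝ) L, φ t • g t :=
  h φ hφ.contDiff hφ.compact hφ.subset

theorem HasWeakDeriv.congr {f g f' g' : ℝ → E} (h : HasWeakDeriv L f g)
    (hf : f =ᵐ[volume.restrict (Set.Ioo (0 : ℝ) L)] f')
    (hg : g =ᵐ[volume.restrict (Set.Ioo (0 : ℝ) L)] g') : HasWeakDeriv L f' g' := by
  intro φ h1 h2 h3
  have e1 : (fun t => deriv φ t • f t) =ᵐ[volume.restrict (Set.Ioo (0 : ℝ) L)]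
      fun t => deriv φ t • f' t := by filter_upwards [hf] with t ht; rw [ht]
  have e2 : (fun t => φ t • g t) =ᵐ[volume.restrict (Set.Ioo (0 : ℝ) L)]
      fun t => φ t • g' t := by filter_upwards [hg] with t ht; rw [ht]
  rw [← integral_congr_ae e1, ← integral_congr_ae e2]
  exact h φ h1 h2 h3

theorem HasWeakDeriv.sub {f g f' g' : ℝ → E} (h : HasWeakDeriv L f g) (h' : HasWeakDeriv L f' g')
    (hf : IntegrableOn f (Set.Ioo 0 L)) (hf' : IntegrableOn f' (Set.Ioo 0 L))
    (hg : IntegrableOn g (Set.Ioo 0 L)) (hg' : IntegrableOn g' (Set.Ioo 0 L)) :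
    HasWeakDeriv L (fun t => f t - f' t) (fun t => g t - g' t) := by
  intro φ h1 h2 h3
  have hφ : IsTest L φ := ⟨h1, h2, h3⟩
  simp only [smul_sub]
  rw [integral_sub (hφ.deriv.integrable_smul hf) (hφ.deriv.integrable_smul hf'),
    integral_sub (hφ.integrable_smul hg) (hφ.integrable_smul hg'), h.eq hφ, h'.eq hφ]
  abel

theorem HasWeakDeriv.ae_eq [CompleteSpace E] {f g g' : ℝ → E} (h : HasWeakDeriv L f g)
    (h' : HasWeakDeriv L f g')
    (hg : IntegrableOn g (Set.Ioo 0 L)) (hg' : IntegrableOn g' (Set.Ioo 0 L)) :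
    g =ᵐ[volume.restrict (Set.Ioo (0 : ℝ) L)] g' := by
  have key : ∀ᵐ t, t ∈ Set.Ioo (0 : ℝ) L → (g - g') t = 0 := by
    refine isOpen_Ioo.ae_eq_zero_of_integral_contDiff_smul_eq_zero
      (IntegrableOn.locallyIntegrableOn (hg.sub hg')) ?_
    intro φ h1 h2 h3
    have hφ : IsTest L φ := ⟨h1, h2, h3⟩
    have hz : ∀ t, t ∉ Set.Ioo 0 L → φ t • (g - g') t = 0 := fun t ht => by
      rw [hφ.eq_zero ht, zero_smul]
    rw [← setIntegral_eq_integral_of_forall_compl_eq_zero hz]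
    simp only [Pi.sub_apply, smul_sub]
    rw [integral_sub (hφ.integrable_smul hg) (hφ.integrable_smul hg'), sub_eq_zero]
    have := (h.eq hφ).symm.trans (h'.eq hφ)
    exact neg_injective this
  rw [EventuallyEq, ae_restrict_iff' measurableSet_Ioo]
  filter_upwards [key] with t ht h1
  exact sub_eq_zero.1 (ht h1)

/-- A continuous function that is differentiable off a countable set, with integrable derivative,
is weakly differentiable. -/
theorem hasWeakDeriv_of_hasDerivAt [CompleteSpace E] (hL : 0 ≤ L) {f f' : ℝ → E} {s : Set ℝ}
    (hs : s.Countable) (hc : Continuous f) (hd : ∀ t ∉ s, HasDerivAt f (f' t) t)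
    (hi : IntegrableOn f' (Set.Ioo 0 L)) : HasWeakDeriv L f f' := by
  intro φ h1 h2 h3
  have hφ : IsTest L φ := ⟨h1, h2, h3⟩
  have hfi : IntegrableOn f (Set.Ioo 0 L) :=
    (hc.integrableOn_Icc (a := 0) (b := L)).mono_set Set.Ioo_subset_Icc_self
  have hi1 : IntegrableOn (fun t => φ t • f' t) (Set.Ioo 0 L) := hφ.integrable_smul hi
  have hi2 : IntegrableOn (fun t => deriv φ t • f t) (Set.Ioo 0 L) := hφ.deriv.integrable_smul hfi
  have := integral_eq_of_hasDerivAt_off_countable_of_le (fun t => φ t • f t)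
    (fun t => φ t • f' t + deriv φ t • f t) hL hs (hφ.continuous.smul hc).continuousOn
    (fun x hx => (hφ.hasDerivAt x).smul (hd x hx.2)) (by
      rw [intervalIntegrable_iff_integrableOn_Ioo_of_le hL]
      exact hi1.add hi2)
  rw [intervalIntegral.integral_of_le hL, integral_Ioc_eq_integral_Ioo,
    integral_add hi1 hi2, hφ.eq_zero (t := 0) (by simp), hφ.eq_zero (t := L) (by simp)] at this
  simp only [zero_smul, sub_zero] at this
  rw [eq_neg_iff_add_eq_zero, add_comm]
  exact this

theorem integrableOn_of_L2 {L : ℝ} {E : Type*} [NormedAddCommGroup E] (f : L2 L E) :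
    IntegrableOn f (Set.Ioo 0 L) :=
  (Lp.memLp f).integrable (by norm_num)

/-- Fubini on the triangle s ≤ t: integrating φ' from s to L leaves -φ(s). This avoids
differentiating the primitive of a merely integrable function. -/
theorem hasWeakDeriv_primitive [CompleteSpace E] {g : ℝ → E}
    (hg : IntegrableOn g (Set.Ioo 0 L)) : HasWeakDeriv L (fun t => ∫ s in (0 : ℝ)..t, g s) g := by
  intro φ h1 h2 h3
  have hφ : IsTest L φ := ⟨h1, h2, h3⟩
  set μ := volume.restrict (Set.Ioo 0 L) with hμ
  have hdi : Integrable (deriv φ) μ :=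
    ((hφ.deriv.continuous).integrableOn_Icc (a := 0) (b := L)).mono_set Set.Ioo_subset_Icc_self
  have hT : MeasurableSet {p : ℝ × ℝ | p.2 ≤ p.1} := measurableSet_le measurable_snd measurable_fst
  have hF : Integrable (Function.uncurry fun t s =>
      {p : ℝ × ℝ | p.2 ≤ p.1}.indicator (fun p => deriv φ p.1 • g p.2) (t, s)) (μ.prod μ) :=
    (hdi.smul_prod hg).indicator hT
  have hsw := integral_integral_swap hF
  have e1 : ∀ t ∈ Set.Ioo 0 L, ∫ s, {p : ℝ × ℝ | p.2 ≤ p.1}.indicator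
      (fun p => deriv φ p.1 • g p.2) (t, s) ∂μ = deriv φ t • ∫ s in (0 : ℝ)..t, g s := by
    intro t ht
    have : (fun s => {p : ℝ × ℝ | p.2 ≤ p.1}.indicator (fun p => deriv φ p.1 • g p.2) (t, s))
        = (Set.Iic t).indicator (fun s => deriv φ t • g s) := by
      ext s; simp [Set.indicator]
    rw [this, integral_indicator measurableSet_Iic, integral_smul,
      intervalIntegral.integral_of_le ht.1.le, hμ, Measure.restrict_restrict measurableSet_Iic]
    congr 3
    ext s; simp only [Set.mem_inter_iff, Set.mem_Iic, Set.mem_Ioo, Set.mem_Ioc]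
    constructor
    · rintro ⟨a, b, c⟩; exact ⟨b, a⟩
    · rintro ⟨a, b⟩; exact ⟨b, a, b.trans_lt ht.2⟩
  have e2 : ∀ s ∈ Set.Ioo 0 L, ∫ t, {p : ℝ × ℝ | p.2 ≤ p.1}.indicator
      (fun p => deriv φ p.1 • g p.2) (t, s) ∂μ = -(φ s • g s) := by
    intro s hs
    have : (fun t => {p : ℝ × ℝ | p.2 ≤ p.1}.indicator (fun p => deriv φ p.1 • g p.2) (t, s))
        = (Set.Ici s).indicator (fun t => deriv φ t • g s) := by
      ext t; simp [Set.indicator]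
    rw [this, integral_indicator measurableSet_Ici, integral_smul_const, hμ,
      Measure.restrict_restrict measurableSet_Ici]
    have hset : Set.Ici s ∩ Set.Ioo 0 L = Set.Ico s L := by
      ext t; simp only [Set.mem_inter_iff, Set.mem_Ici, Set.mem_Ioo, Set.mem_Ico]
      constructor
      · rintro ⟨a, b, c⟩; exact ⟨a, c⟩
      · rintro ⟨a, b⟩; exact ⟨a, hs.1.trans_le a, b⟩
    rw [hset, integral_Ico_eq_integral_Ioo, ← integral_Ioc_eq_integral_Ioo,
      ← intervalIntegral.integral_of_le hs.2.le,
      intervalIntegral.integral_eq_sub_of_hasDerivAt (fun t _ => hφ.hasDerivAt t)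
        (hφ.deriv.continuous.intervalIntegrable _ _), hφ.eq_zero (t := L) (by simp)]
    simp
  rw [← integral_neg]
  calc _ = ∫ t, (∫ s, {p : ℝ × ℝ | p.2 ≤ p.1}.indicator
      (fun p => deriv φ p.1 • g p.2) (t, s) ∂μ) ∂μ :=
        (setIntegral_congr_fun measurableSet_Ioo e1).symm
    _ = _ := hsw.trans (setIntegral_congr_fun measurableSet_Ioo e2)

theorem exists_isTest_integral_eq_one (hL : 0 < L) :
    ∃ ψ, IsTest L ψ ∧ ∫ t in Set.Ioo 0 L, ψ t = 1 := by
  let b : ContDiffBump (L / 2) := ⟨L / 8, L / 4, by positivity, by linarith⟩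
  have hb : IsTest L (b.normed volume) := by
    refine ⟨b.contDiff_normed, b.hasCompactSupport_normed, ?_⟩
    rw [b.tsupport_normed_eq, Real.closedBall_eq_Icc]
    intro t ht
    have h1 : L / 2 - L / 4 ≤ t := ht.1
    have h2 : t ≤ L / 2 + L / 4 := ht.2
    constructor <;> linarith
  refine ⟨_, hb, ?_⟩
  rw [setIntegral_eq_integral_of_forall_compl_eq_zero fun t ht => hb.eq_zero ht]
  exact b.integral_normed

/-- To the right of the support of φ the primitive from 0 equals the total integral, so zero mean is
what makes it compactly supported. -/
theorem IsTest.exists_primitive {φ : ℝ → ℝ} (hL : 0 < L) (hφ : IsTest L φ)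
    (h0 : ∫ t in Set.Ioo 0 L, φ t = 0) : ∃ χ, IsTest L χ ∧ deriv χ = φ := by
  set χ : ℝ → ℝ := fun t => ∫ s in (0 : ℝ)..t, φ s with hχ
  have hd : ∀ t, HasDerivAt χ (φ t) t := fun t =>
    intervalIntegral.integral_hasDerivAt_right (hφ.continuous.intervalIntegrable _ _)
      (hφ.continuous.stronglyMeasurableAtFilter _ _) hφ.continuous.continuousAt
  have hder : deriv χ = φ := funext fun t => (hd t).deriv
  -- The extreme points of the support serve; if the support is empty, any interior point does.
  obtain ⟨a, b, hab⟩ : ∃ a b, 0 < a ∧ b < L ∧ tsupport φ ⊆ Set.Icc a b := by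
    rcases (tsupport φ).eq_empty_or_nonempty with he | hne
    · exact ⟨L / 2, L / 2, by linarith, by linarith, by simp [he]⟩
    · have hcpt : IsCompact (tsupport φ) := hφ.compact
      exact ⟨sInf (tsupport φ), sSup (tsupport φ), (hφ.subset (hcpt.sInf_mem hne)).1,
        (hφ.subset (hcpt.sSup_mem hne)).2,
        fun t ht => ⟨csInf_le hcpt.bddBelow ht, le_csSup hcpt.bddAbove ht⟩⟩
  obtain ⟨ha, hb, hsub⟩ := hab
  have hz : ∀ t, t ∉ Set.Icc a b → φ t = 0 := fun t ht =>
    image_eq_zero_of_notMem_tsupport fun h => ht (hsub h)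
  have hzero : ∀ t, t ∉ Set.Icc a b → χ t = 0 := by
    intro t ht
    rw [Set.mem_Icc, not_and_or, not_le, not_le] at ht
    rcases ht with ht | ht
    · refine (intervalIntegral.integral_congr (g := fun _ => (0 : ℝ)) fun s hs => ?_).trans (by simp)
      apply hz
      intro h
      have := hs.2
      rcases le_total 0 t with h' | h'
      · rw [sup_eq_right.2 h'] at this; linarith [h.1]
      · rw [sup_eq_left.2 h'] at this; linarith [h.1]
    · have e1 : ∫ s in (0 : ℝ)..L, φ s = 0 := by
        rw [intervalIntegral.integral_of_le hL.le, integral_Ioc_eq_integral_Ioo, h0]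
      have e2 : ∫ s in t..L, φ s = 0 := by
        refine (intervalIntegral.integral_congr (g := fun _ => (0 : ℝ)) fun s hs => ?_).trans (by simp)
        apply hz
        intro h
        have := hs.1
        rcases le_total L t with h' | h'
        · rw [inf_eq_right.2 h'] at this; linarith [h.2]
        · rw [inf_eq_left.2 h'] at this; linarith [h.2]
      have := intervalIntegral.integral_add_adjacent_intervals
        (hφ.continuous.intervalIntegrable (μ := volume) 0 t)
        (hφ.continuous.intervalIntegrable (μ := volume) t L)
      rw [e1, e2, add_zero] at this
      exact this
  have hts : tsupport χ ⊆ Set.Icc a b :=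
    closure_minimal (fun t ht => by_contra fun h => ht (hzero t h)) isClosed_Icc
  refine ⟨χ, ⟨?_, HasCompactSupport.of_support_subset_isCompact isCompact_Icc
    ((subset_tsupport χ).trans hts), fun t ht =>
      ⟨ha.trans_le (hts ht).1, (hts ht).2.trans_lt hb⟩⟩, hder⟩
  rw [contDiff_infty_iff_deriv, hder]
  exact ⟨fun t => (hd t).differentiableAt, hφ.contDiff⟩

/-- The lemma of du Bois-Reymond. -/
theorem HasWeakDeriv.ae_const [CompleteSpace E] (hL : 0 < L) {f : ℝ → E}
    (h : HasWeakDeriv L f fun _ => 0) (hf : IntegrableOn f (Set.Ioo 0 L)) :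
    ∃ c, f =ᵐ[volume.restrict (Set.Ioo (0 : ℝ) L)] fun _ => c := by
  obtain ⟨ψ, hψ, hψ1⟩ := exists_isTest_integral_eq_one hL
  refine ⟨∫ t in Set.Ioo 0 L, ψ t • f t, ?_⟩
  set c := ∫ t in Set.Ioo 0 L, ψ t • f t with hc
  have hci : IntegrableOn (fun _ : ℝ => c) (Set.Ioo 0 L) := integrableOn_const (by simp)
  have key : ∀ᵐ t, t ∈ Set.Ioo (0 : ℝ) L → f t - c = 0 := by
    refine isOpen_Ioo.ae_eq_zero_of_integral_contDiff_smul_eq_zero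
      (IntegrableOn.locallyIntegrableOn (hf.sub hci)) ?_
    intro φ h1 h2 h3
    have hφ : IsTest L φ := ⟨h1, h2, h3⟩
    have hz : ∀ t, t ∉ Set.Ioo 0 L → φ t • (f t - c) = 0 := fun t ht => by
      rw [hφ.eq_zero ht, zero_smul]
    rw [← setIntegral_eq_integral_of_forall_compl_eq_zero hz]
    set m := ∫ t in Set.Ioo 0 L, φ t with hm
    have hint : ∀ {φ : ℝ → ℝ}, IsTest L φ → IntegrableOn φ (Set.Ioo 0 L) := fun h =>
      (h.continuous.integrableOn_Icc (a := 0) (b := L)).mono_set Set.Ioo_subset_Icc_self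
    -- Subtracting m ψ gives mean zero, so this function is the derivative of a test function and f
    -- integrates to zero against it. Thus ∫ φ f = m c.
    have ht : IsTest L (fun t => φ t - m * ψ t) := hφ.sub (hψ.const_mul m)
    obtain ⟨χ, hχ, hχd⟩ := ht.exists_primitive hL (by
      rw [integral_sub (hint hφ) (hint (hψ.const_mul m)), integral_const_mul, hψ1]
      simp [hm])
    have e := h.eq hχ
    simp only [hχd, sub_smul, mul_smul, smul_zero, integral_zero, neg_zero] at e
    rw [integral_sub (hφ.integrable_smul hf) (Integrable.fun_smul m (hψ.integrable_smul hf)),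
      integral_smul, ← hc] at e
    simp only [smul_sub]
    rw [integral_sub (hφ.integrable_smul hf) (hφ.integrable_smul hci), integral_smul_const]
    exact e
  rw [EventuallyEq, ae_restrict_iff' measurableSet_Ioo]
  filter_upwards [key] with t ht h1
  exact sub_eq_zero.1 (ht h1)

theorem continuousOn_primitive_Ioo (hL : 0 ≤ L) {g : ℝ → E} (hg : IntegrableOn g (Set.Ioo 0 L)) :
    ContinuousOn (fun t => ∫ s in (0 : ℝ)..t, g s) (Set.Icc 0 L) := by
  have := intervalIntegral.continuousOn_primitive_interval (μ := volume) (f := g) (a := 0) (b := L)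
    (by rw [Set.uIcc_of_le hL]; exact (integrableOn_Icc_iff_integrableOn_Ioo (by simp) (by simp)).2 hg)
  rwa [Set.uIcc_of_le hL] at this

/-- A weakly differentiable function is a.e. the integral of its weak derivative. -/
theorem HasWeakDeriv.exists_ae_eq_primitive [CompleteSpace E] (hL : 0 < L) {f g : ℝ → E}
    (h : HasWeakDeriv L f g) (hf : IntegrableOn f (Set.Ioo 0 L))
    (hg : IntegrableOn g (Set.Ioo 0 L)) :
    ∃ c, f =ᵐ[volume.restrict (Set.Ioo (0 : ℝ) L)] fun t => c + ∫ s in (0 : ℝ)..t, g s := by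
  have hp : IntegrableOn (fun t => ∫ s in (0 : ℝ)..t, g s) (Set.Ioo 0 L) :=
    ((continuousOn_primitive_Ioo hL.le hg).integrableOn_Icc).mono_set Set.Ioo_subset_Icc_self
  have hd := h.sub (hasWeakDeriv_primitive hg) hf hp hg hg
  simp only [sub_self] at hd
  obtain ⟨c, hc⟩ := hd.ae_const hL (hf.sub hp)
  refine ⟨c, ?_⟩
  filter_upwards [hc] with t ht
  rw [← ht]; abel

theorem IsW12.hasWeakDeriv {f : L2 L E} (h : IsW12 f) : HasWeakDeriv L f (weakDeriv f) := by
  rw [weakDeriv, dif_pos h]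
  exact h.choose_spec

/-- Uniqueness of weak derivatives makes the arbitrary choice in `weakDeriv` harmless. -/
theorem HasWeakDeriv.weakDeriv_eq [CompleteSpace E] {f g : L2 L E} (h : HasWeakDeriv L f g) :
    weakDeriv f = g :=
  Lp.ext ((IsW12.hasWeakDeriv ⟨g, h⟩).ae_eq h (integrableOn_of_L2 _) (integrableOn_of_L2 _))

end Weak

end KirchhoffRod

/-! ### Weak limits in L². -/

namespace KirchhoffRod

section Weak

open scoped InnerProductSpace

/-- Banach–Alaoglu through the Riesz isomorphism. An ultrafilter gives a limit directly, with
neither separability nor a further subsequence. -/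
theorem exists_weak_limit {ι H : Type*} [NormedAddCommGroup H] [InnerProductSpace ℝ H]
    [CompleteSpace H] (U : Ultrafilter ι) {g : ι → H} {C : ℝ} (hg : ∀ᶠ i in U, ‖g i‖ ≤ C) :
    ∃ x : H, ∀ h : H, Tendsto (fun i => ⟪g i, h⟫_ℝ) U (𝓝 ⟪x, h⟫_ℝ) := by
  let G : ι → WeakDual ℝ H := fun i =>
    StrongDual.toWeakDual (InnerProductSpace.toDual ℝ H (g i))
  have hc := WeakDual.isCompact_closedBall (0 : StrongDual ℝ H) C
  obtain ⟨x, -, hx⟩ := hc.ultrafilter_le_nhds (U.map G) (by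
    rw [le_principal_iff, Ultrafilter.mem_coe, Ultrafilter.mem_map]
    filter_upwards [hg] with i hi
    simpa [G] using hi)
  refine ⟨(InnerProductSpace.toDual ℝ H).symm (WeakDual.toStrongDual x), fun h => ?_⟩
  have hx' : Tendsto G U (𝓝 x) := hx
  have := ((WeakDual.eval_continuous h).tendsto x).comp hx'
  simpa [G, Function.comp_def] using this

variable {E : Type*} [NormedAddCommGroup E] [InnerProductSpace ℝ E] {L : ℝ}

theorem IsTest.memLp_smul {φ : ℝ → ℝ} (hφ : IsTest L φ) (e : E) :
    MemLp (fun t => φ t • e) 2 (volume.restrict (Set.Ioo (0 : ℝ) L)) := by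
  obtain ⟨C, hC⟩ := hφ.exists_bound
  refine MemLp.of_bound (hφ.continuous.smul continuous_const).aestronglyMeasurable (C * ‖e‖)
    (ae_of_all _ fun t => ?_)
  rw [norm_smul]
  exact mul_le_mul_of_nonneg_right (hC t) (norm_nonneg e)

/-- The definition of weak derivative involves vector-valued integrals; paired with a vector e they
become L² inner products, on which weak convergence acts. -/
theorem inner_toLp_test [CompleteSpace E] {φ : ℝ → ℝ} (hφ : IsTest L φ) (e : E) (f : L2 L E) :
    ⟪f, (hφ.memLp_smul e).toLp _⟫_ℝ = ⟪e, ∫ t in Set.Ioo 0 L, φ t • f t⟫_ℝ := by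
  rw [L2.inner_def, ← integral_inner (hφ.integrable_smul (integrableOn_of_L2 f))]
  refine integral_congr_ae ?_
  filter_upwards [(hφ.memLp_smul e).coeFn_toLp] with t ht
  rw [ht, inner_smul_right, inner_smul_right, real_inner_comm]

/-- Weak derivatives pass to weak limits. -/
theorem HasWeakDeriv.of_weak_limit [CompleteSpace E] {ι : Type*} {l : Filter ι} [l.NeBot]
    {f g : ι → L2 L E} {f₀ g₀ : L2 L E} (h : ∀ i, HasWeakDeriv L (f i) (g i))
    (hf : ∀ k, Tendsto (fun i => ⟪f i, k⟫_ℝ) l (𝓝 ⟪f₀, k⟫_ℝ))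
    (hg : ∀ k, Tendsto (fun i => ⟪g i, k⟫_ℝ) l (𝓝 ⟪g₀, k⟫_ℝ)) : HasWeakDeriv L f₀ g₀ := by
  intro φ h1 h2 h3
  have hφ : IsTest L φ := ⟨h1, h2, h3⟩
  refine ext_inner_left ℝ fun e => ?_
  have a := hf ((hφ.deriv.memLp_smul e).toLp _)
  have b := (hg ((hφ.memLp_smul e).toLp _)).neg
  rw [inner_neg_right, ← inner_toLp_test hφ.deriv, ← inner_toLp_test hφ]
  refine tendsto_nhds_unique a (b.congr fun i => ?_)
  rw [inner_toLp_test hφ.deriv, inner_toLp_test hφ, (h i).eq hφ, inner_neg_right]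

end Weak

/-! ### L² norms, Hölder bounds for primitives, and differences of averages. -/

section Norm

variable {E : Type*} [NormedAddCommGroup E] {L : ℝ}

theorem integrableOn_sq_norm (g : L2 L E) : IntegrableOn (fun t => ‖g t‖ ^ 2) (Set.Ioo 0 L) :=
  (Lp.memLp g).integrable_norm_pow (by norm_num)

theorem lintegral_enorm_sq (g : L2 L E) :
    ∫⁻ t in Set.Ioo 0 L, ‖g t‖ₑ ^ 2 = ENNReal.ofReal (‖g‖ ^ 2) := by
  have h := eLpNorm_nnreal_pow_eq_lintegral (p := 2) (μ := volume.restrict (Set.Ioo (0 : ℝ) L))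
    (f := g) (by norm_num)
  have h2 : ((2 : NNReal) : ℝ) = ((2 : ℕ) : ℝ) := by norm_num
  rw [h2] at h
  simp only [ENNReal.rpow_natCast] at h
  rw [← h, ENNReal.ofReal_pow (norm_nonneg _), ofReal_norm, Lp.enorm_def]
  rfl

theorem setIntegral_sq_norm (g : L2 L E) : ∫ t in Set.Ioo 0 L, ‖g t‖ ^ 2 = ‖g‖ ^ 2 := by
  rw [integral_eq_lintegral_of_nonneg_ae (ae_of_all _ fun t => by positivity)
    (integrableOn_sq_norm g).aestronglyMeasurable]
  have : ∀ t, ENNReal.ofReal (‖g t‖ ^ 2) = ‖g t‖ₑ ^ 2 := fun t => by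
    rw [ENNReal.ofReal_pow (norm_nonneg _), ofReal_norm]
  simp only [this]
  rw [lintegral_enorm_sq, ENNReal.toReal_ofReal (by positivity)]

theorem intervalIntegrable_of_Ioo {f : ℝ → E} (hf : IntegrableOn f (Set.Ioo 0 L)) {a b : ℝ}
    (ha : a ∈ Set.Icc 0 L) (hb : b ∈ Set.Icc 0 L) : IntervalIntegrable f volume a b := by
  have hL : 0 ≤ L := ha.1.trans ha.2
  rw [← intervalIntegrable_iff_integrableOn_Ioo_of_le hL] at hf
  exact hf.mono_set (by
    rw [Set.uIcc_of_le hL]; exact Set.uIcc_subset_Icc ha hb)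

theorem intervalIntegral_sq_norm (hL : 0 ≤ L) (g : L2 L E) :
    ∫ t in (0 : ℝ)..L, ‖g t‖ ^ 2 = ‖g‖ ^ 2 := by
  rw [intervalIntegral.integral_of_le hL, integral_Ioc_eq_integral_Ioo, setIntegral_sq_norm]

theorem intervalIntegral_sq_norm_le (g : L2 L E) {a b : ℝ} (ha : a ∈ Set.Icc 0 L)
    (hb : b ∈ Set.Icc 0 L) (hab : a ≤ b) : ∫ t in a..b, ‖g t‖ ^ 2 ≤ ‖g‖ ^ 2 := by
  have hL : 0 ≤ L := ha.1.trans ha.2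
  rw [← intervalIntegral_sq_norm hL]
  exact intervalIntegral.integral_mono_interval ha.1 hab hb.2 (ae_of_all _ fun t => by positivity)
    (intervalIntegrable_of_Ioo (integrableOn_sq_norm g) ⟨le_rfl, hL⟩ ⟨hL, le_rfl⟩)

variable [NormedSpace ℝ E]

/-- Cauchy–Schwarz, obtained by expanding ∫ (‖g‖ - mean)² ≥ 0. -/
theorem sq_norm_intervalIntegral_le {g : ℝ → E} {a b : ℝ} (hab : a ≤ b)
    (h1 : IntervalIntegrable g volume a b)
    (h2 : IntervalIntegrable (fun t => ‖g t‖ ^ 2) volume a b) :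
    ‖∫ t in a..b, g t‖ ^ 2 ≤ (b - a) * ∫ t in a..b, ‖g t‖ ^ 2 := by
  rcases hab.eq_or_lt with rfl | hlt
  · simp
  have hn := intervalIntegral.norm_integral_le_integral_norm (f := g) (μ := volume) hab
  set I := ∫ t in a..b, ‖g t‖
  set J := ∫ t in a..b, ‖g t‖ ^ 2
  have hT : 0 < b - a := sub_pos.2 hlt
  have hi1 : IntervalIntegrable (fun t => 2 * (I / (b - a)) * ‖g t‖) volume a b :=
    h1.norm.const_mul _
  have hpos : 0 ≤ ∫ t in a..b, (‖g t‖ ^ 2 - 2 * (I / (b - a)) * ‖g t‖ + (I / (b - a)) ^ 2) :=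
    intervalIntegral.integral_nonneg hab fun t _ => by nlinarith [sq_nonneg (‖g t‖ - I / (b - a))]
  rw [intervalIntegral.integral_add (h2.sub hi1) (by simp),
    intervalIntegral.integral_sub h2 hi1, intervalIntegral.integral_const_mul,
    intervalIntegral.integral_const, smul_eq_mul] at hpos
  have : 0 ≤ (b - a) * (J - 2 * (I / (b - a)) * I + (b - a) * (I / (b - a)) ^ 2) :=
    mul_nonneg hT.le hpos
  have e : (b - a) * (J - 2 * (I / (b - a)) * I + (b - a) * (I / (b - a)) ^ 2)
      = (b - a) * J - I ^ 2 := by field_simp; ring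
  rw [e] at this
  have h3 : ‖∫ t in a..b, g t‖ ^ 2 ≤ I ^ 2 := pow_le_pow_left₀ (norm_nonneg _) hn 2
  linarith

/-- Primitives of `L²` functions are Hölder continuous. -/
theorem norm_intervalIntegral_le_sqrt (g : L2 L E) {a b : ℝ} (ha : a ∈ Set.Icc 0 L)
    (hb : b ∈ Set.Icc 0 L) : ‖∫ t in a..b, g t‖ ≤ √|b - a| * ‖g‖ := by
  wlog hab : a ≤ b generalizing a b
  · rw [intervalIntegral.integral_symm, norm_neg, abs_sub_comm]
    exact this hb ha (le_of_not_ge hab)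
  refine abs_le_of_sq_le_sq' ?_ (by positivity) |>.2
  rw [mul_pow, Real.sq_sqrt (abs_nonneg _), abs_of_nonneg (sub_nonneg.2 hab)]
  exact (sq_norm_intervalIntegral_le hab (intervalIntegrable_of_Ioo (integrableOn_of_L2 g) ha hb)
    (intervalIntegrable_of_Ioo (integrableOn_sq_norm g) ha hb)).trans
    (mul_le_mul_of_nonneg_left (intervalIntegral_sq_norm_le g ha hb hab) (sub_nonneg.2 hab))

/-- A translation puts integrals over two neighbouring cells on the same cell. -/
theorem integral_window_sub {f : ℝ → E} {a b h : ℝ} (hab : a ≤ b) (hh : 0 ≤ h)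
    (hf : ContinuousOn f (Set.Icc a (b + h))) :
    ContinuousOn (fun t => f (t + h) - f t) (Set.Icc a b) ∧
      (∫ t in a + h..b + h, f t) - ∫ t in a..b, f t = ∫ t in a..b, (f (t + h) - f t) := by
  have c1 : ContinuousOn (fun t => f (t + h)) (Set.Icc a b) :=
    hf.comp (by fun_prop) fun t ht => ⟨by linarith [ht.1], by linarith [ht.2]⟩
  have c2 : ContinuousOn f (Set.Icc a b) := hf.mono (Set.Icc_subset_Icc_right (by linarith))
  refine ⟨c1.sub c2, ?_⟩
  rw [intervalIntegral.integral_sub (ContinuousOn.intervalIntegrable (by rwa [Set.uIcc_of_le hab]))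
    (ContinuousOn.intervalIntegrable (by rwa [Set.uIcc_of_le hab])),
    intervalIntegral.integral_comp_add_right]

/-- Differences of consecutive averages are controlled by the derivative. -/
theorem sum_sq_norm_sub_average_le (g : L2 L E) {F : ℝ → E}
    (hF : ContinuousOn F (Set.Icc 0 L))
    (hFg : ∀ a ∈ Set.Icc 0 L, ∀ b ∈ Set.Icc 0 L, F b - F a = ∫ t in a..b, g t)
    {N : ℕ} (hN : 0 < N) {h : ℝ} (hh : 0 < h) (hNh : N * h = L) (A : ℕ → E)
    (hA : ∀ i ∈ Finset.Icc 1 N, A i = h⁻¹ • ∫ t in ((i : ℝ) - 1) * h..i * h, F t) :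
    ∑ i ∈ Finset.Ico 1 N, ‖A (i + 1) - A i‖ ^ 2 ≤ h * ‖g‖ ^ 2 := by
  have hL : 0 ≤ L := by rw [← hNh]; positivity
  -- Cauchy–Schwarz gives ‖F(t+h) - F(t)‖² ≤ h (Q(t+h) - Q(t)). A second application over the cell
  -- bounds ‖A(i+1) - A(i)‖² by the increment of the cell integrals of Q.
  set Q : ℝ → ℝ := fun t => ∫ s in (0 : ℝ)..t, ‖g s‖ ^ 2 with hQ
  have hmem : ∀ x : ℝ, 0 ≤ x → x ≤ N → x * h ∈ Set.Icc 0 L := fun x h0 h1 =>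
    ⟨by positivity, by rw [← hNh]; gcongr⟩
  have hQc : ContinuousOn Q (Set.Icc 0 L) := continuousOn_primitive_Ioo hL (integrableOn_sq_norm g)
  have hgi : ∀ {a b : ℝ}, a ∈ Set.Icc 0 L → b ∈ Set.Icc 0 L →
      IntervalIntegrable (fun t => ‖g t‖ ^ 2) volume a b := fun ha hb =>
    intervalIntegrable_of_Ioo (integrableOn_sq_norm g) ha hb
  set B : ℕ → ℝ := fun i => ∫ t in ((i : ℝ) - 1) * h..i * h, Q t with hB
  have hQ0 : ∀ t ∈ Set.Icc 0 L, 0 ≤ Q t := fun t ht =>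
    intervalIntegral.integral_nonneg ht.1 fun s _ => by positivity
  have step : ∀ i ∈ Finset.Ico 1 N, ‖A (i + 1) - A i‖ ^ 2 ≤ B (i + 1) - B i := by
    intro i hi
    rw [Finset.mem_Ico] at hi
    have hi1 : (1 : ℝ) ≤ i := by exact_mod_cast hi.1
    have hi2 : (i : ℝ) + 1 ≤ N := by exact_mod_cast hi.2
    have m0 : ((i : ℝ) - 1) * h ∈ Set.Icc 0 L := hmem _ (by linarith) (by linarith)
    have m2 : (i : ℝ) * h + h ∈ Set.Icc 0 L := by
      have := hmem ((i : ℝ) + 1) (by linarith) (by linarith)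
      rwa [add_mul, one_mul] at this
    have hle : ((i : ℝ) - 1) * h ≤ i * h := by gcongr; linarith
    have e1 : (((i + 1 : ℕ) : ℝ) - 1) * h = ((i : ℝ) - 1) * h + h := by push_cast; ring
    have e2 : ((i + 1 : ℕ) : ℝ) * h = i * h + h := by push_cast; ring
    have hsub : Set.Icc (((i : ℝ) - 1) * h) (i * h + h) ⊆ Set.Icc 0 L :=
      Set.Icc_subset_Icc m0.1 m2.2
    have mt : ∀ t ∈ Set.Icc (((i : ℝ) - 1) * h) (i * h), t ∈ Set.Icc 0 L ∧ t + h ∈ Set.Icc 0 L :=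
      fun t ht => ⟨⟨m0.1.trans ht.1, by linarith [m2.2, ht.2]⟩,
        by linarith [m0.1, ht.1], by linarith [m2.2, ht.2]⟩
    obtain ⟨cF, eF⟩ := integral_window_sub hle hh.le (hF.mono hsub)
    obtain ⟨cQ, eQ⟩ := integral_window_sub hle hh.le (hQc.mono hsub)
    rw [← Set.uIcc_of_le hle] at cF cQ
    have eA : A (i + 1) - A i = h⁻¹ • ∫ t in ((i : ℝ) - 1) * h..i * h, (F (t + h) - F t) := by
      rw [hA _ (Finset.mem_Icc.2 ⟨by omega, by omega⟩), hA _ (Finset.mem_Icc.2 ⟨hi.1, by omega⟩),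
        e1, e2, ← smul_sub, eF]
    have eB : B (i + 1) - B i = ∫ t in ((i : ℝ) - 1) * h..i * h, (Q (t + h) - Q t) := by
      rw [← eQ, ← e1, ← e2]
    have jen := sq_norm_intervalIntegral_le hle cF.intervalIntegrable
      (cF.norm.pow 2).intervalIntegrable
    have hlen : (i : ℝ) * h - (i - 1) * h = h := by ring
    rw [hlen] at jen
    have pt : ∫ t in ((i : ℝ) - 1) * h..i * h, ‖F (t + h) - F t‖ ^ 2
        ≤ ∫ t in ((i : ℝ) - 1) * h..i * h, h * (Q (t + h) - Q t) := by
      refine intervalIntegral.integral_mono_on hle (cF.norm.pow 2).intervalIntegrable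
        (continuousOn_const.mul cQ).intervalIntegrable fun t ht => ?_
      obtain ⟨ma, mb⟩ := mt t ht
      rw [hFg t ma _ mb]
      have := sq_norm_intervalIntegral_le (g := g) (a := t) (b := t + h) (by linarith)
        (intervalIntegrable_of_Ioo (integrableOn_of_L2 g) ma mb) (hgi ma mb)
      have e : Q (t + h) - Q t = ∫ s in t..t + h, ‖g s‖ ^ 2 :=
        intervalIntegral.integral_interval_sub_left (hgi ⟨le_rfl, hL⟩ mb) (hgi ⟨le_rfl, hL⟩ ma)
      rw [e]
      simpa using this
    rw [intervalIntegral.integral_const_mul, ← eB] at pt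
    rw [eA, norm_smul, mul_pow, norm_inv, Real.norm_of_nonneg hh.le]
    calc h⁻¹ ^ 2 * ‖∫ t in ((i : ℝ) - 1) * h..i * h, (F (t + h) - F t)‖ ^ 2
        ≤ h⁻¹ ^ 2 * (h * (h * (B (i + 1) - B i))) := by
          refine mul_le_mul_of_nonneg_left (jen.trans ?_) (by positivity)
          exact mul_le_mul_of_nonneg_left pt hh.le
      _ = B (i + 1) - B i := by field_simp
  -- The increments telescope to B N - B 1, where B 1 ≥ 0 and B N ≤ h ‖g‖². This keeps the constant
  -- 1, which convergence of the energies requires.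
  refine (Finset.sum_le_sum step).trans ?_
  rw [Finset.sum_Ico_sub B hN]
  have m0 : ((N : ℝ) - 1) * h ∈ Set.Icc 0 L :=
    hmem _ (by rw [sub_nonneg]; exact_mod_cast hN) (by linarith)
  have m1 : (N : ℝ) * h ∈ Set.Icc 0 L := hmem _ (by positivity) le_rfl
  have b1 : 0 ≤ B 1 := by
    rw [hB]
    refine intervalIntegral.integral_nonneg (by simp [hh.le]) fun t ht => hQ0 t ?_
    have : ((1 : ℕ) : ℝ) * h ≤ N * h := by gcongr; exact_mod_cast hN
    refine ⟨by simpa using ht.1, ht.2.trans (this.trans m1.2)⟩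
  have b2 : B N ≤ h * ‖g‖ ^ 2 := by
    have hle : ((N : ℝ) - 1) * h ≤ N * h := by gcongr; linarith
    have : B N ≤ ∫ t in ((N : ℝ) - 1) * h..N * h, ‖g‖ ^ 2 :=
      intervalIntegral.integral_mono_on hle (ContinuousOn.intervalIntegrable
        (hQc.mono (Set.uIcc_subset_Icc m0 m1))) (by simp) fun t ht =>
        intervalIntegral_sq_norm_le g ⟨le_rfl, hL⟩ ⟨m0.1.trans ht.1, ht.2.trans m1.2⟩
          (m0.1.trans ht.1)
    rw [intervalIntegral.integral_const, smul_eq_mul] at this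
    calc _ ≤ _ := this
      _ = _ := by ring
  linarith

end Norm

end KirchhoffRod

/-! ### Gluing pieces along increasing knots. -/

namespace KirchhoffRod

section Glue

variable {E : Type*}

/-- The function equal to `P 0` up to `k 1`, to `P i` on `(k i, k (i + 1)]`, and to `P n` after
`k n`. -/
noncomputable def glue (k : ℕ → ℝ) (P : ℕ → ℝ → E) : ℕ → ℝ → E
  | 0 => P 0
  | m + 1 => fun τ => if τ ≤ k (m + 1) then glue k P m τ else P (m + 1) τ

variable {k : ℕ → ℝ} {P P' : ℕ → ℝ → E} {n : ℕ}

theorem glue_succ_of_le {τ : ℝ} (h : τ ≤ k (n + 1)) : glue k P (n + 1) τ = glue k P n τ := if_pos h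

theorem glue_succ_of_lt {τ : ℝ} (h : k (n + 1) < τ) : glue k P (n + 1) τ = P (n + 1) τ :=
  if_neg (not_le.2 h)

theorem StrictMonoOn.of_succ (hk : StrictMonoOn k (Set.Icc 1 (n + 1))) :
    StrictMonoOn k (Set.Icc 1 n) := hk.mono (Set.Icc_subset_Icc_right (by omega))

theorem glue_eq_before (hk : StrictMonoOn k (Set.Icc 1 n)) {τ : ℝ} (hτ : τ ≤ k 1) :
    glue k P n τ = P 0 τ := by
  induction n with
  | zero => rfl
  | succ m ih =>
    have : k 1 ≤ k (m + 1) := hk.monotoneOn ⟨le_rfl, by omega⟩ ⟨by omega, le_rfl⟩ (by omega)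
    rw [glue_succ_of_le (hτ.trans this)]
    exact ih (StrictMonoOn.of_succ hk)

theorem glue_eq_last_of_lt {τ : ℝ} (h : n = 0 ∨ k n < τ) : glue k P n τ = P n τ := by
  cases n with
  | zero => rfl
  | succ m => exact glue_succ_of_lt (h.resolve_left (by omega))

theorem eq_zero_or_knot_lt (hk : StrictMonoOn k (Set.Icc 1 (n + 1))) : n = 0 ∨ k n < k (n + 1) := by
  rcases Nat.eq_zero_or_pos n with h | h
  · exact Or.inl h
  · exact Or.inr (hk ⟨h, by omega⟩ ⟨by omega, le_rfl⟩ (by omega))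

theorem glue_eq_at (hk : StrictMonoOn k (Set.Icc 1 (n + 1))) :
    glue k P n (k (n + 1)) = P n (k (n + 1)) :=
  glue_eq_last_of_lt (eq_zero_or_knot_lt hk)

theorem glue_eq_last (hk : StrictMonoOn k (Set.Icc 1 n)) (hn : 1 ≤ n)
    (hm : ∀ i < n, P i (k (i + 1)) = P (i + 1) (k (i + 1))) {τ : ℝ} (hτ : k n ≤ τ) :
    glue k P n τ = P n τ := by
  obtain ⟨m, rfl⟩ : ∃ m, n = m + 1 := ⟨n - 1, by omega⟩
  rcases hτ.eq_or_lt with h | h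
  · rw [← h, glue_succ_of_le le_rfl, glue_eq_at hk, hm m (by omega)]
  · exact glue_succ_of_lt h

theorem glue_eq_mid (hk : StrictMonoOn k (Set.Icc 1 n))
    (hm : ∀ i < n, P i (k (i + 1)) = P (i + 1) (k (i + 1))) {i : ℕ} (hi : 1 ≤ i) (hin : i < n)
    {τ : ℝ} (h1 : k i ≤ τ) (h2 : τ ≤ k (i + 1)) : glue k P n τ = P i τ := by
  induction n with
  | zero => omega
  | succ m ih =>
    have : k (i + 1) ≤ k (m + 1) := hk.monotoneOn ⟨by omega, by omega⟩ ⟨by omega, le_rfl⟩ (by omega)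
    rw [glue_succ_of_le (h2.trans this)]
    rcases (Nat.lt_succ_iff.1 hin).eq_or_lt with rfl | h
    · exact glue_eq_last (StrictMonoOn.of_succ hk) hi (fun j hj => hm j (by omega)) h1
    · exact ih (StrictMonoOn.of_succ hk) (fun j hj => hm j (by omega)) h

/-- The left endpoint is excluded, so the pieces need not match; this serves the accelerations and
slopes, which may jump at knots. -/
theorem glue_eq_mid_of_lt (hk : StrictMonoOn k (Set.Icc 1 n)) {i : ℕ} (hi : 1 ≤ i) (hin : i < n)
    {τ : ℝ} (h1 : k i < τ) (h2 : τ ≤ k (i + 1)) : glue k P n τ = P i τ := by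
  induction n with
  | zero => omega
  | succ m ih =>
    have : k (i + 1) ≤ k (m + 1) := hk.monotoneOn ⟨by omega, by omega⟩ ⟨by omega, le_rfl⟩ (by omega)
    rw [glue_succ_of_le (h2.trans this)]
    rcases (Nat.lt_succ_iff.1 hin).eq_or_lt with rfl | h
    · exact glue_eq_last_of_lt (Or.inr h1)
    · exact ih (StrictMonoOn.of_succ hk) h

theorem exists_mem_Ioc_knot (hn : 1 ≤ n) {τ : ℝ} (h1 : k 1 < τ) (h2 : τ ≤ k n) :
    ∃ i, 1 ≤ i ∧ i < n ∧ k i < τ ∧ τ ≤ k (i + 1) := by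
  induction n, hn using Nat.le_induction with
  | base => exact absurd h1 (not_lt.2 h2)
  | succ m hm ih =>
    rcases lt_or_ge (k m) τ with h | h
    · exact ⟨m, hm, by omega, h, h2⟩
    · obtain ⟨i, a, b, c⟩ := ih h
      exact ⟨i, a, by omega, c⟩

theorem exists_mem_Ico_knot (hn : 1 ≤ n) {τ : ℝ} (h1 : k 1 ≤ τ) (h2 : τ < k n) :
    ∃ i, 1 ≤ i ∧ i < n ∧ k i ≤ τ ∧ τ < k (i + 1) := by
  induction n, hn using Nat.le_induction with
  | base => exact absurd h1 (not_le.2 h2)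
  | succ m hm ih =>
    rcases le_or_gt (k m) τ with h | h
    · exact ⟨m, hm, by omega, h, h2⟩
    · obtain ⟨i, a, b, c⟩ := ih h
      exact ⟨i, a, by omega, c⟩

/-- The recursive form of `glue` allows regularity to be proved by induction on the number of knots.
The two forms assign interior knots to different neighbouring pieces, hence the matching hypothesis.
-/
theorem ite_sum_indicator_eq_glue [AddCommMonoid E] (hk : StrictMonoOn k (Set.Icc 1 n)) (hn : 1 ≤ n)
    (hm : ∀ i < n, P i (k (i + 1)) = P (i + 1) (k (i + 1))) (τ : ℝ) :
    (if τ ≤ k 1 then P 0 τ else if k n ≤ τ then P n τ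
      else ∑ i ∈ Finset.Ico 1 n, (Set.Ico (k i) (k (i + 1))).indicator (P i) τ) = glue k P n τ := by
  split_ifs with h1 h2
  · exact (glue_eq_before hk h1).symm
  · exact (glue_eq_last hk hn hm h2).symm
  · rw [not_le] at h1 h2
    obtain ⟨i, hi, hin, hl, hr⟩ := exists_mem_Ico_knot hn h1.le h2
    rw [glue_eq_mid hk hm hi hin hl hr.le, Finset.sum_eq_single i,
      Set.indicator_of_mem (show τ ∈ Set.Ico (k i) (k (i + 1)) from ⟨hl, hr⟩)]
    · intro j hj hji
      rw [Finset.mem_Ico] at hj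
      refine Set.indicator_of_notMem (fun h => ?_) _
      rcases lt_or_gt_of_ne hji with hlt | hlt
      · exact absurd (h.2.trans_le ((hk.monotoneOn ⟨by omega, by omega⟩ ⟨hi, hin.le⟩
          (by omega : j + 1 ≤ i)).trans hl)) (lt_irrefl _)
      · exact absurd (hr.trans_le ((hk.monotoneOn ⟨by omega, by omega⟩ ⟨hj.1, by omega⟩
          (by omega : i + 1 ≤ j)).trans h.1)) (lt_irrefl _)
    · intro h
      exact absurd (Finset.mem_Ico.2 ⟨hi, hin⟩) h

variable [NormedAddCommGroup E]

theorem continuous_glue (hk : StrictMonoOn k (Set.Icc 1 n)) (hP : ∀ i ≤ n, Continuous (P i))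
    (hm : ∀ i < n, P i (k (i + 1)) = P (i + 1) (k (i + 1))) : Continuous (glue k P n) := by
  induction n with
  | zero => exact hP 0 le_rfl
  | succ m ih =>
    refine Continuous.if_le (ih (StrictMonoOn.of_succ hk) (fun i hi => hP i (by omega))
      fun i hi => hm i (by omega)) (hP _ le_rfl) continuous_id continuous_const ?_
    intro x hx
    obtain rfl : x = k (m + 1) := hx
    rw [glue_eq_at hk, hm m (by omega)]

theorem stronglyMeasurable_glue (hP : ∀ i ≤ n, StronglyMeasurable (P i)) :
    StronglyMeasurable (glue k P n) := by
  induction n with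
  | zero => exact hP 0 le_rfl
  | succ m ih =>
    exact StronglyMeasurable.ite measurableSet_Iic (ih fun i hi => hP i (by omega)) (hP _ le_rfl)

theorem exists_bound_glue (hP : ∀ i ≤ n, Continuous (P i)) (a b : ℝ) :
    ∃ C, ∀ τ ∈ Set.Icc a b, ‖glue k P n τ‖ ≤ C := by
  induction n with
  | zero => exact isCompact_Icc.exists_bound_of_continuousOn (hP 0 le_rfl).continuousOn
  | succ m ih =>
    obtain ⟨C, hC⟩ := ih fun i hi => hP i (by omega)
    obtain ⟨D, hD⟩ := (isCompact_Icc (a := a) (b := b)).exists_bound_of_continuousOn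
      (hP (m + 1) le_rfl).continuousOn
    refine ⟨max C D, fun τ hτ => ?_⟩
    rcases le_or_gt τ (k (m + 1)) with h | h
    · rw [glue_succ_of_le h]; exact (hC τ hτ).trans (le_max_left _ _)
    · rw [glue_succ_of_lt h]; exact (hD τ hτ).trans (le_max_right _ _)

variable [NormedSpace ℝ E]

theorem hasDerivAt_glue_of_ne (hP : ∀ i ≤ n, ∀ τ, HasDerivAt (P i) (P' i τ) τ) {τ : ℝ}
    (hτ : ∀ i ∈ Set.Icc 1 n, τ ≠ k i) : HasDerivAt (glue k P n) (glue k P' n τ) τ := by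
  induction n with
  | zero => exact hP 0 le_rfl τ
  | succ m ih =>
    rcases lt_or_gt_of_ne (hτ (m + 1) ⟨by omega, le_rfl⟩) with h | h
    · rw [glue_succ_of_le h.le]
      refine (ih (fun i hi => hP i (by omega)) fun i hi => hτ i ⟨hi.1, hi.2.trans (by omega)⟩)
        |>.congr_of_eventuallyEq ?_
      filter_upwards [Iio_mem_nhds h] with s hs using glue_succ_of_le (le_of_lt hs)
    · rw [glue_succ_of_lt h]
      refine (hP (m + 1) le_rfl τ).congr_of_eventuallyEq ?_
      filter_upwards [Ioi_mem_nhds h] with s hs using glue_succ_of_lt hs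

theorem hasDerivAt_glue (hk : StrictMonoOn k (Set.Icc 1 n))
    (hP : ∀ i ≤ n, ∀ τ, HasDerivAt (P i) (P' i τ) τ)
    (hm : ∀ i < n, P i (k (i + 1)) = P (i + 1) (k (i + 1)))
    (hm' : ∀ i < n, P' i (k (i + 1)) = P' (i + 1) (k (i + 1))) (τ : ℝ) :
    HasDerivAt (glue k P n) (glue k P' n τ) τ := by
  induction n with
  | zero => exact hP 0 le_rfl τ
  | succ m ih =>
    have ih' := ih (StrictMonoOn.of_succ hk) (fun i hi => hP i (by omega))
      (fun i hi => hm i (by omega)) fun i hi => hm' i (by omega)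
    rcases lt_trichotomy τ (k (m + 1)) with h | h | h
    · rw [glue_succ_of_le h.le]
      refine ih'.congr_of_eventuallyEq ?_
      filter_upwards [Iio_mem_nhds h] with s hs using glue_succ_of_le (le_of_lt hs)
    · subst h
      -- At the knot the one-sided derivatives are computed separately; `hm'` makes them agree.
      rw [← hasDerivWithinAt_univ, ← Set.Iic_union_Ici (a := k (m + 1))]
      refine HasDerivWithinAt.union ?_ ?_
      · rw [glue_succ_of_le le_rfl]
        exact ih'.hasDerivWithinAt.congr (fun s hs => glue_succ_of_le hs) (glue_succ_of_le le_rfl)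
      · have e : glue k P (m + 1) (k (m + 1)) = P (m + 1) (k (m + 1)) := by
          rw [glue_succ_of_le le_rfl, glue_eq_at hk, hm m (by omega)]
        have e' : glue k P' (m + 1) (k (m + 1)) = P' (m + 1) (k (m + 1)) := by
          rw [glue_succ_of_le le_rfl, glue_eq_at hk, hm' m (by omega)]
        rw [e']
        refine (hP (m + 1) le_rfl _).hasDerivWithinAt.congr (fun s hs => ?_) e
        rcases (Set.mem_Ici.1 hs).eq_or_lt with rfl | h
        · exact e
        · exact glue_succ_of_lt h
    · rw [glue_succ_of_lt h]
      refine (hP (m + 1) le_rfl τ).congr_of_eventuallyEq ?_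
      filter_upwards [Ioi_mem_nhds h] with s hs using glue_succ_of_lt hs

end Glue

/-! ### Polynomial pieces of the spline and of the angle function. -/

section Rod

variable {N : ℕ} {X : Fin (N + 1) → E3} {L : ℝ}

theorem IsRod.edgeLength_pos (hX : IsRod X) {i : ℕ} (h1 : 1 ≤ i) (h2 : i ≤ N) :
    0 < edgeLength X i :=
  norm_pos_iff.2 (sub_ne_zero.2 (hX.2 i (Finset.mem_Icc.2 ⟨h1, h2⟩)))

theorem edgeLength_nonneg (i : ℕ) : 0 ≤ edgeLength X i := norm_nonneg _

theorem IsRod.edgeLength_smul_edgeDir (hX : IsRod X) {i : ℕ} (h1 : 1 ≤ i) (h2 : i ≤ N) :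
    edgeLength X i • edgeDir X i = vertex X i - vertex X (i - 1) :=
  smul_inv_smul₀ (hX.edgeLength_pos h1 h2).ne' _

theorem IsRod.norm_edgeDir (hX : IsRod X) {i : ℕ} (h1 : 1 ≤ i) (h2 : i ≤ N) :
    ‖edgeDir X i‖ = 1 := by
  rw [edgeDir, norm_smul, norm_inv, Real.norm_of_nonneg (edgeLength_nonneg i)]
  exact inv_mul_cancel₀ (hX.edgeLength_pos h1 h2).ne'

theorem IsRod.polyLength_pos (hX : IsRod X) : 0 < polyLength X :=
  Finset.sum_pos (fun _ hi => hX.edgeLength_pos (Finset.mem_Icc.1 hi).1 (Finset.mem_Icc.1 hi).2)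
    ⟨1, Finset.mem_Icc.2 ⟨le_rfl, hX.1⟩⟩

theorem IsRod.stretch_pos (hX : IsRod X) (hL : 0 < L) : 0 < stretch L X :=
  div_pos hX.polyLength_pos hL

theorem knot_one : knot X 1 = edgeLength X 1 / 2 := by
  simp [knot]; ring

theorem knot_succ_sub {i : ℕ} : knot X (i + 1) - knot X i
    = (edgeLength X i + edgeLength X (i + 1)) / 2 := by
  rw [knot, knot, Finset.sum_Icc_succ_top (by omega)]; ring

theorem polyLength_sub_knot : polyLength X - knot X N = edgeLength X N / 2 := by
  rw [polyLength, knot]; ring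

theorem IsRod.knot_strictMonoOn (hX : IsRod X) : StrictMonoOn (knot X) (Set.Icc 1 N) := by
  refine strictMonoOn_of_lt_add_one Set.ordConnected_Icc fun i _ h1 h2 => ?_
  have a := hX.edgeLength_pos h1.1 h1.2
  have b := hX.edgeLength_pos h2.1 h2.2
  have := knot_succ_sub (X := X) (i := i)
  linarith

theorem IsRod.edgeMid_eq_left (hX : IsRod X) {i : ℕ} (h1 : 1 ≤ i) (h2 : i ≤ N) :
    edgeMid X i = vertex X (i - 1) + (edgeLength X i / 2) • edgeDir X i := by
  rw [div_eq_inv_mul, mul_smul, hX.edgeLength_smul_edgeDir h1 h2, edgeMid]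
  module

theorem IsRod.edgeMid_eq_right (hX : IsRod X) {i : ℕ} (h1 : 1 ≤ i) (h2 : i ≤ N) :
    edgeMid X i = vertex X i - (edgeLength X i / 2) • edgeDir X i := by
  rw [div_eq_inv_mul, mul_smul, hX.edgeLength_smul_edgeDir h1 h2, edgeMid]
  module

/-- The polynomial pieces of the spline. -/
noncomputable def curvePiece (X : Fin (N + 1) → E3) (i : ℕ) (τ : ℝ) : E3 :=
  if i = 0 then vertex X 0 + τ • edgeDir X 1
  else if N ≤ i then vertex X N - (polyLength X - τ) • edgeDir X N
  else hermite (knot X (i + 1) - knot X i) (edgeMid X i) (edgeMid X (i + 1))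
      (edgeDir X i) (edgeDir X (i + 1)) (τ - knot X i)

/-- The derivatives of the pieces of the spline. -/
noncomputable def velocityPiece (X : Fin (N + 1) → E3) (i : ℕ) (τ : ℝ) : E3 :=
  if i = 0 then edgeDir X 1
  else if N ≤ i then edgeDir X N
  else deriv (hermite (knot X (i + 1) - knot X i) (edgeMid X i) (edgeMid X (i + 1))
      (edgeDir X i) (edgeDir X (i + 1))) (τ - knot X i)

/-- The second derivatives of the pieces of the spline. -/
noncomputable def accelPiece (X : Fin (N + 1) → E3) (i : ℕ) (τ : ℝ) : E3 :=
  if i = 0 then 0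
  else if N ≤ i then 0
  else ((knot X (i + 1) - knot X i)⁻¹ * (1 + 3 * ((edgeLength X i - edgeLength X (i + 1)) /
      (edgeLength X i + edgeLength X (i + 1))) *
      (2 * (τ - knot X i) / (knot X (i + 1) - knot X i) - 1))) • (edgeDir X (i + 1) - edgeDir X i)

theorem hasDerivAt_curvePiece (i : ℕ) (τ : ℝ) :
    HasDerivAt (curvePiece X i) (velocityPiece X i τ) τ := by
  unfold curvePiece velocityPiece
  split_ifs with h1 h2
  · simpa using ((hasDerivAt_id τ).smul_const (edgeDir X 1)).const_add (vertex X 0)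
  · simpa using (((hasDerivAt_id τ).const_sub (polyLength X)).smul_const
      (edgeDir X N)).const_sub (vertex X N)
  · refine HasDerivAt.comp_sub_const τ (knot X i) (HasDerivAt.congr_deriv
      (hasDerivAt_hermite _ _ _ _ _ _) ?_)
    rw [(hasDerivAt_hermite _ _ _ _ _ _).deriv]

/-- Consecutive midpoints differ by half of each adjacent edge, and the knot spacing is half the sum
of their lengths. With these data the coefficients of the two tangents in the second derivative of
the cubic are opposite, so only their difference remains. For equal edges the piece is quadratic. -/
theorem IsRod.hasDerivAt_velocityPiece (hX : IsRod X) (i : ℕ) (τ : ℝ) :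
    HasDerivAt (velocityPiece X i) (accelPiece X i τ) τ := by
  unfold velocityPiece accelPiece
  split_ifs with h1 h2
  · exact hasDerivAt_const _ _
  · exact hasDerivAt_const _ _
  · have hl := hX.edgeLength_pos (i := i) (by omega) (by omega)
    have hm := hX.edgeLength_pos (i := i + 1) (by omega) (by omega)
    have hab : edgeMid X (i + 1) - edgeMid X i = (edgeLength X i / 2) • edgeDir X i
        + (edgeLength X (i + 1) / 2) • edgeDir X (i + 1) := by
      rw [hX.edgeMid_eq_right (i := i) (by omega) (by omega),
        hX.edgeMid_eq_left (i := i + 1) (by omega) (by omega)]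
      simp only [Nat.add_sub_cancel]
      abel
    have hd : ∀ T s : ℝ, ∀ a b v w : E3, HasDerivAt (deriv (hermite T a b v w))
        ((2 : ℝ) • ((3 / T ^ 2) • (b - a) - (1 / T) • ((2 : ℝ) • v + w))
        + (6 * s) • ((1 / T ^ 2) • (v + w) - (2 / T ^ 3) • (b - a))) s := by
      intro T s a b v w
      have e : deriv (hermite T a b v w) = fun s =>
          (v + (2 * s) • ((3 / T ^ 2) • (b - a) - (1 / T) • ((2 : ℝ) • v + w))
          + (3 * s ^ 2) • ((1 / T ^ 2) • (v + w) - (2 / T ^ 3) • (b - a))) :=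
        funext fun s => (hasDerivAt_hermite T a b v w s).deriv
      rw [e]
      have h := (((hasDerivAt_id s).const_mul (2 : ℝ)).smul_const
        ((3 / T ^ 2) • (b - a) - (1 / T) • ((2 : ℝ) • v + w))).const_add v |>.add
        ((((hasDerivAt_id s).pow 2).const_mul (3 : ℝ)).smul_const
          ((1 / T ^ 2) • (v + w) - (2 / T ^ 3) • (b - a)))
      refine HasDerivAt.congr_deriv h ?_
      simp only [id, mul_one, Nat.cast_ofNat, Nat.add_one_sub_one, pow_one]
      congr 2
      ring
    refine HasDerivAt.comp_sub_const τ (knot X i) (HasDerivAt.congr_deriv (hd _ _ _ _ _ _) ?_)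
    rw [hab, knot_succ_sub]
    generalize edgeLength X i = l at *
    generalize edgeLength X (i + 1) = m at *
    generalize τ - knot X i = s
    have : l + m ≠ 0 := by positivity
    match_scalars <;> field_simp <;> ring

theorem velocityPiece_left {i : ℕ} (h1 : 1 ≤ i) (h2 : i ≤ N) :
    velocityPiece X i (knot X i) = edgeDir X i := by
  rw [velocityPiece, if_neg (by omega)]
  split_ifs with h
  · congr 1; omega
  · rw [sub_self, deriv_hermite_zero]

theorem IsRod.knot_lt (hX : IsRod X) {i : ℕ} (h1 : 1 ≤ i) (h2 : i < N) :
    knot X i < knot X (i + 1) :=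
  hX.knot_strictMonoOn ⟨h1, h2.le⟩ ⟨by omega, h2⟩ (by omega)

theorem velocityPiece_right (hX : IsRod X) {i : ℕ} (h2 : i < N) :
    velocityPiece X i (knot X (i + 1)) = edgeDir X (i + 1) := by
  rw [velocityPiece, if_neg (not_le.2 h2)]
  split_ifs with h
  · rw [h]
  · exact deriv_hermite_end (sub_pos.2 (hX.knot_lt (by omega) h2)).ne' _ _ _ _

theorem curvePiece_left (hX : IsRod X) {i : ℕ} (h1 : 1 ≤ i) (h2 : i ≤ N) :
    curvePiece X i (knot X i) = edgeMid X i := by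
  rw [curvePiece, if_neg (by omega)]
  split_ifs with h
  · obtain rfl : N = i := by omega
    rw [polyLength_sub_knot, hX.edgeMid_eq_right h1 h2]
  · rw [sub_self, hermite_zero]

theorem curvePiece_right (hX : IsRod X) {i : ℕ} (h2 : i < N) :
    curvePiece X i (knot X (i + 1)) = edgeMid X (i + 1) := by
  rw [curvePiece, if_neg (not_le.2 h2)]
  split_ifs with h
  · subst h
    rw [zero_add, knot_one, hX.edgeMid_eq_left le_rfl h2]
  · exact hermite_end (sub_pos.2 (hX.knot_lt (by omega) h2)).ne' _ _ _ _

theorem curvePiece_match (hX : IsRod X) (i : ℕ) (h : i < N) :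
    curvePiece X i (knot X (i + 1)) = curvePiece X (i + 1) (knot X (i + 1)) := by
  rw [curvePiece_right hX h, curvePiece_left hX (by omega) h]

theorem velocityPiece_match (hX : IsRod X) (i : ℕ) (h : i < N) :
    velocityPiece X i (knot X (i + 1)) = velocityPiece X (i + 1) (knot X (i + 1)) := by
  rw [velocityPiece_right hX h, velocityPiece_left (by omega) h]

theorem splineCurve_eq_glue (hX : IsRod X) : splineCurve X = glue (knot X) (curvePiece X) N := by
  funext τ
  rw [← ite_sum_indicator_eq_glue hX.knot_strictMonoOn hX.1 (curvePiece_match hX), splineCurve]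
  refine if_congr Iff.rfl (by simp [curvePiece]) (if_congr Iff.rfl
    (by rw [curvePiece, if_neg (by have := hX.1; omega), if_pos le_rfl])
    (Finset.sum_congr rfl fun i hi => ?_))
  rw [Finset.mem_Ico] at hi
  congr 1
  funext s
  rw [curvePiece, if_neg (by omega), if_neg (by omega)]

/-- The affine pieces of the angle function. -/
noncomputable def anglePiece (X : Fin (N + 1) → E3) (Φ : Fin N → ℝ) (i : ℕ) (τ : ℝ) : ℝ :=
  if i = 0 then angle Φ 1
  else if N ≤ i then angle Φ N
  else angle Φ i + (angle Φ (i + 1) - angle Φ i) / (knot X (i + 1) - knot X i) * (τ - knot X i)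

/-- The slopes of the pieces of the angle function. -/
noncomputable def slopePiece (X : Fin (N + 1) → E3) (Φ : Fin N → ℝ) (i : ℕ) (_ : ℝ) : ℝ :=
  if i = 0 then 0
  else if N ≤ i then 0
  else (angle Φ (i + 1) - angle Φ i) / (knot X (i + 1) - knot X i)

variable {Φ : Fin N → ℝ}

theorem hasDerivAt_anglePiece (i : ℕ) (τ : ℝ) :
    HasDerivAt (anglePiece X Φ i) (slopePiece X Φ i τ) τ := by
  unfold anglePiece slopePiece
  split_ifs with h1 h2
  · exact hasDerivAt_const _ _
  · exact hasDerivAt_const _ _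
  · simpa using (((hasDerivAt_id τ).sub_const (knot X i)).const_mul
      ((angle Φ (i + 1) - angle Φ i) / (knot X (i + 1) - knot X i))).const_add (angle Φ i)

theorem anglePiece_match (hX : IsRod X) (i : ℕ) (h : i < N) :
    anglePiece X Φ i (knot X (i + 1)) = anglePiece X Φ (i + 1) (knot X (i + 1)) := by
  have e1 : anglePiece X Φ i (knot X (i + 1)) = angle Φ (i + 1) := by
    rw [anglePiece, if_neg (not_le.2 h)]
    split_ifs with h0
    · rw [h0]
    · rw [div_mul_cancel₀ _ (sub_pos.2 (hX.knot_lt (by omega) h)).ne']; ring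
  have e2 : anglePiece X Φ (i + 1) (knot X (i + 1)) = angle Φ (i + 1) := by
    rw [anglePiece, if_neg (by omega)]
    split_ifs with h0
    · congr 1; omega
    · simp
  rw [e1, e2]

theorem splineAngle_eq_glue (hX : IsRod X) :
    splineAngle X Φ = glue (knot X) (anglePiece X Φ) N := by
  funext τ
  rw [← ite_sum_indicator_eq_glue hX.knot_strictMonoOn hX.1 (anglePiece_match hX), splineAngle]
  refine if_congr Iff.rfl (by simp [anglePiece]) (if_congr Iff.rfl
    (by rw [anglePiece, if_neg (by have := hX.1; omega), if_pos le_rfl])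
    (Finset.sum_congr rfl fun i hi => ?_))
  rw [Finset.mem_Ico] at hi
  congr 1
  funext s
  rw [anglePiece, if_neg (by omega), if_neg (by omega)]

end Rod

end KirchhoffRod

/-! ### Derivatives of the rescaled rod, pointwise and in L². -/

namespace KirchhoffRod

variable {N : ℕ} {X : Fin (N + 1) → E3} {Φ : Fin N → ℝ} {L : ℝ}

/-- The derivative of `rodCurve`. -/
noncomputable def rodVelocity (L : ℝ) (X : Fin (N + 1) → E3) (t : ℝ) : E3 :=
  stretch L X • glue (knot X) (velocityPiece X) N (stretch L X * t)

/-- The second derivative of `rodCurve`, off the knots. -/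
noncomputable def rodAccel (L : ℝ) (X : Fin (N + 1) → E3) (t : ℝ) : E3 :=
  stretch L X • stretch L X • glue (knot X) (accelPiece X) N (stretch L X * t)

/-- The derivative of `rodAngle`, off the knots. -/
noncomputable def rodSlope (L : ℝ) (X : Fin (N + 1) → E3) (Φ : Fin N → ℝ) (t : ℝ) : ℝ :=
  stretch L X • glue (knot X) (slopePiece X Φ) N (stretch L X * t)

/-- The parameters of the knots. -/
def knotSet (L : ℝ) (X : Fin (N + 1) → E3) : Set ℝ := (fun i => knot X i / stretch L X) '' Set.Icc 1 N

theorem finite_knotSet : (knotSet L X).Finite := (Set.finite_Icc 1 N).image _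

theorem IsRod.ne_knot (hX : IsRod X) (hL : 0 < L) {t : ℝ} (ht : t ∉ knotSet L X) :
    ∀ i ∈ Set.Icc 1 N, stretch L X * t ≠ knot X i := fun i hi h =>
  ht ⟨i, hi, by simp only [← h]; field_simp [(hX.stretch_pos hL).ne']⟩

theorem IsRod.hasDerivAt_rodCurve (hX : IsRod X) (t : ℝ) :
    HasDerivAt (rodCurve L X) (rodVelocity L X t) t := by
  have h := hasDerivAt_glue hX.knot_strictMonoOn (fun i _ τ => hasDerivAt_curvePiece i τ)
    (curvePiece_match hX) (velocityPiece_match hX) (stretch L X * t)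
  rw [← splineCurve_eq_glue hX] at h
  exact HasDerivAt.scomp t h (by simpa using (hasDerivAt_id t).const_mul (stretch L X))

theorem IsRod.hasDerivAt_rodVelocity (hX : IsRod X) (hL : 0 < L) {t : ℝ} (ht : t ∉ knotSet L X) :
    HasDerivAt (rodVelocity L X) (rodAccel L X t) t := by
  have h := hasDerivAt_glue_of_ne (n := N) (fun i _ τ => hX.hasDerivAt_velocityPiece i τ)
    (hX.ne_knot hL ht)
  exact (HasDerivAt.scomp t h
    (by simpa using (hasDerivAt_id t).const_mul (stretch L X))).const_smul (stretch L X)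

theorem IsRod.hasDerivAt_rodAngle (hX : IsRod X) (hL : 0 < L) {t : ℝ} (ht : t ∉ knotSet L X) :
    HasDerivAt (rodAngle L X Φ) (rodSlope L X Φ t) t := by
  have h := hasDerivAt_glue_of_ne (n := N)
    (fun i _ τ => hasDerivAt_anglePiece (X := X) (Φ := Φ) i τ) (hX.ne_knot hL ht)
  rw [← splineAngle_eq_glue hX] at h
  exact HasDerivAt.scomp t h (by simpa using (hasDerivAt_id t).const_mul (stretch L X))

theorem IsRod.continuous_rodCurve (hX : IsRod X) : Continuous (rodCurve L X) :=
  continuous_iff_continuousAt.2 fun t => (hX.hasDerivAt_rodCurve t).continuousAt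

theorem IsRod.continuous_velocityPiece (hX : IsRod X) (i : ℕ) : Continuous (velocityPiece X i) :=
  continuous_iff_continuousAt.2 fun t => (hX.hasDerivAt_velocityPiece i t).continuousAt

theorem continuous_accelPiece (i : ℕ) : Continuous (accelPiece X i) := by
  unfold accelPiece
  split_ifs <;> fun_prop

theorem continuous_slopePiece (i : ℕ) : Continuous (slopePiece X Φ i) := by
  unfold slopePiece
  split_ifs <;> fun_prop

theorem IsRod.continuous_rodVelocity (hX : IsRod X) : Continuous (rodVelocity L X) :=
  ((continuous_glue hX.knot_strictMonoOn (fun i _ => hX.continuous_velocityPiece i)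
    (velocityPiece_match hX)).comp (continuous_const_mul (stretch L X))).const_smul
    (stretch L X)

theorem IsRod.continuous_rodAngle (hX : IsRod X) : Continuous (rodAngle L X Φ) := by
  have h := continuous_glue hX.knot_strictMonoOn
    (fun i _ => continuous_iff_continuousAt.2 fun t =>
      (hasDerivAt_anglePiece (X := X) (Φ := Φ) i t).continuousAt) (anglePiece_match hX)
  rw [← splineAngle_eq_glue hX] at h
  exact h.comp (by fun_prop : Continuous fun t => stretch L X * t)

theorem memLp_of_continuous {E : Type*} [NormedAddCommGroup E] {f : ℝ → E} (hf : Continuous f) :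
    MemLp f 2 (volume.restrict (Set.Ioo (0 : ℝ) L)) := by
  obtain ⟨C, hC⟩ := (isCompact_Icc (a := 0) (b := L)).exists_bound_of_continuousOn hf.continuousOn
  refine MemLp.of_bound hf.aestronglyMeasurable.restrict C ?_
  filter_upwards [ae_restrict_mem measurableSet_Ioo] with t ht using hC t (Set.Ioo_subset_Icc_self ht)

theorem memLp_glue {E : Type*} [NormedAddCommGroup E] {k : ℕ → ℝ} {P : ℕ → ℝ → E}
    (hP : ∀ i, Continuous (P i)) {c : ℝ} (hc : 0 ≤ c) :
    MemLp (fun t => glue k P N (c * t)) 2 (volume.restrict (Set.Ioo (0 : ℝ) L)) := by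
  obtain ⟨C, hC⟩ := exists_bound_glue (k := k) (n := N) (fun i _ => hP i) 0 (c * L)
  refine MemLp.of_bound ((stronglyMeasurable_glue fun i _ => (hP i).stronglyMeasurable)
    |>.comp_measurable (measurable_const_mul c)).aestronglyMeasurable.restrict C ?_
  filter_upwards [ae_restrict_mem measurableSet_Ioo] with t ht
  exact hC _ ⟨mul_nonneg hc ht.1.le, mul_le_mul_of_nonneg_left ht.2.le hc⟩

theorem IsRod.memLp_rodAccel (hX : IsRod X) (hL : 0 < L) :
    MemLp (rodAccel L X) 2 (volume.restrict (Set.Ioo (0 : ℝ) L)) :=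
  ((memLp_glue continuous_accelPiece (hX.stretch_pos hL).le).const_smul
    (stretch L X)).const_smul (stretch L X)

theorem IsRod.memLp_rodSlope (hX : IsRod X) (hL : 0 < L) :
    MemLp (rodSlope L X Φ) 2 (volume.restrict (Set.Ioo (0 : ℝ) L)) :=
  (memLp_glue continuous_slopePiece (hX.stretch_pos hL).le).const_smul (stretch L X)

theorem ae_notMem_knotSet : ∀ᵐ t ∂(volume.restrict (Set.Ioo (0 : ℝ) L)), t ∉ knotSet L X :=
  ae_restrict_of_ae (finite_knotSet.countable.ae_notMem volume)

/-- `deriv` may take its default value at knots, but these form a null set. -/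
theorem IsRod.bendEnergy_eq (hX : IsRod X) (hL : 0 < L) :
    bendEnergy L X = ∫⁻ t in Set.Ioo (0 : ℝ) L, ‖rodAccel L X t‖ₑ ^ 2 := by
  have h : deriv (rodCurve L X) = rodVelocity L X := funext fun t => (hX.hasDerivAt_rodCurve t).deriv
  rw [bendEnergy, h]
  refine lintegral_congr_ae ?_
  filter_upwards [ae_notMem_knotSet (X := X)] with t ht
  rw [(hX.hasDerivAt_rodVelocity hL ht).deriv]

theorem IsRod.torEnergy_eq (hX : IsRod X) (hL : 0 < L) :
    torEnergy L X Φ = ∫⁻ t in Set.Ioo (0 : ℝ) L, ‖rodSlope L X Φ t‖ₑ ^ 2 := by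
  refine lintegral_congr_ae ?_
  filter_upwards [ae_notMem_knotSet (X := X)] with t ht
  rw [(hX.hasDerivAt_rodAngle hL ht).deriv]

/-- `rodVelocity` as an element of `L²`. -/
noncomputable def IsRod.velocity (hX : IsRod X) (L : ℝ) : L2 L E3 :=
  (memLp_of_continuous hX.continuous_rodVelocity).toLp (rodVelocity L X)

/-- `rodAccel` as an element of `L²`. -/
noncomputable def IsRod.accel (hX : IsRod X) (hL : 0 < L) : L2 L E3 :=
  (hX.memLp_rodAccel hL).toLp (rodAccel L X)

/-- `rodSlope` as an element of `L²`. -/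
noncomputable def IsRod.slope (hX : IsRod X) (hL : 0 < L) (Φ : Fin N → ℝ) : L2 L ℝ :=
  (hX.memLp_rodSlope hL).toLp (rodSlope L X Φ)

theorem IsRod.coeFn_accel (hX : IsRod X) (hL : 0 < L) :
    hX.accel hL =ᵐ[volume.restrict (Set.Ioo (0 : ℝ) L)] rodAccel L X := MemLp.coeFn_toLp _

theorem IsRod.bendEnergy_eq_norm (hX : IsRod X) (hL : 0 < L) :
    bendEnergy L X = ENNReal.ofReal (‖hX.accel hL‖ ^ 2) := by
  rw [hX.bendEnergy_eq hL, ← lintegral_enorm_sq]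
  refine lintegral_congr_ae ?_
  filter_upwards [hX.coeFn_accel hL] with t ht
  rw [ht]

theorem IsRod.torEnergy_eq_norm (hX : IsRod X) (hL : 0 < L) :
    torEnergy L X Φ = ENNReal.ofReal (‖hX.slope hL Φ‖ ^ 2) := by
  rw [hX.torEnergy_eq hL, ← lintegral_enorm_sq]
  refine lintegral_congr_ae ?_
  filter_upwards [(hX.memLp_rodSlope (Φ := Φ) hL).coeFn_toLp] with t ht
  rw [IsRod.slope, ht]

theorem IsRod.hasWeakDeriv_rodCurve (hX : IsRod X) (hL : 0 < L) :
    HasWeakDeriv L (rodCurve L X) (rodVelocity L X) :=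
  hasWeakDeriv_of_hasDerivAt hL.le Set.countable_empty hX.continuous_rodCurve
    (fun t _ => hX.hasDerivAt_rodCurve t)
    ((hX.continuous_rodVelocity.integrableOn_Icc).mono_set Set.Ioo_subset_Icc_self)

theorem IsRod.hasWeakDeriv_velocity (hX : IsRod X) (hL : 0 < L) :
    HasWeakDeriv L (hX.velocity L) (hX.accel hL) :=
  (hasWeakDeriv_of_hasDerivAt hL.le finite_knotSet.countable hX.continuous_rodVelocity
    (fun _ ht => hX.hasDerivAt_rodVelocity hL ht)
    ((hX.memLp_rodAccel hL).integrable (by norm_num))).congr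
    (MemLp.coeFn_toLp _).symm (MemLp.coeFn_toLp _).symm

theorem IsRod.hasWeakDeriv_rodAngle (hX : IsRod X) (hL : 0 < L) :
    HasWeakDeriv L (rodAngle L X Φ) (rodSlope L X Φ) :=
  hasWeakDeriv_of_hasDerivAt hL.le finite_knotSet.countable hX.continuous_rodAngle
    (fun _ ht => hX.hasDerivAt_rodAngle hL ht)
    ((hX.memLp_rodSlope hL).integrable (by norm_num))

theorem Represents.hasWeakDeriv_fst {p : L2 L E3 × L2 L ℝ} (h : Represents L X Φ p) (hL : 0 < L) :
    HasWeakDeriv L p.1 (h.1.velocity L) :=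
  (h.1.hasWeakDeriv_rodCurve hL).congr h.2.1.symm (MemLp.coeFn_toLp _).symm

theorem Represents.hasWeakDeriv_snd {p : L2 L E3 × L2 L ℝ} (h : Represents L X Φ p) (hL : 0 < L) :
    HasWeakDeriv L p.2 (h.1.slope hL Φ) :=
  (h.1.hasWeakDeriv_rodAngle hL).congr h.2.2.symm (MemLp.coeFn_toLp _).symm

/-! ### Hölder estimates, and the speed of the spline. -/

theorem norm_sub_le_sqrt_mul_norm {E : Type*} [NormedAddCommGroup E] [NormedSpace ℝ E]
    [CompleteSpace E] {f g : ℝ → E} {s : Set ℝ} (hs : s.Countable) (hf : Continuous f)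
    (hd : ∀ t ∉ s, HasDerivAt f (g t) t)
    (hg : MemLp g 2 (volume.restrict (Set.Ioo (0 : ℝ) L))) {x y : ℝ}
    (hx : x ∈ Set.Icc 0 L) (hy : y ∈ Set.Icc 0 L) :
    ‖f y - f x‖ ≤ √|y - x| * ‖hg.toLp g‖ := by
  have hae : ∀ᵐ r, r ∈ Set.Ioo (0 : ℝ) L → hg.toLp g r = g r :=
    (ae_restrict_iff' measurableSet_Ioo).1 hg.coeFn_toLp
  rw [← integral_eq_of_hasDerivAt_off_countable f g hs hf.continuousOn (fun x hx => hd x hx.2)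
    (intervalIntegrable_of_Ioo (hg.integrable (by norm_num)) hx hy),
    intervalIntegral.integral_congr_ae (g := hg.toLp g)]
  · exact norm_intervalIntegral_le_sqrt _ hx hy
  -- The L² class is controlled only on the open interval, while the half-open interval of
  -- integration may contain L; that point is discarded.
  · filter_upwards [hae, (Set.finite_singleton L).countable.ae_notMem volume] with r hr hrL hmem
    refine (hr ⟨lt_of_le_of_lt (le_min hx.1 hy.1) hmem.1, lt_of_le_of_ne
      (hmem.2.trans (max_le hx.2 hy.2)) hrL⟩).symm

theorem IsRod.norm_rodVelocity_sub_le (hX : IsRod X) (hL : 0 < L) {s t : ℝ}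
    (hs : s ∈ Set.Icc 0 L) (ht : t ∈ Set.Icc 0 L) :
    ‖rodVelocity L X t - rodVelocity L X s‖ ≤ √|t - s| * ‖hX.accel hL‖ :=
  norm_sub_le_sqrt_mul_norm finite_knotSet.countable hX.continuous_rodVelocity
    (fun _ h => hX.hasDerivAt_rodVelocity hL h) (hX.memLp_rodAccel hL) hs ht

theorem IsRod.norm_rodAngle_sub_le (hX : IsRod X) (hL : 0 < L) {s t : ℝ}
    (hs : s ∈ Set.Icc 0 L) (ht : t ∈ Set.Icc 0 L) :
    ‖rodAngle L X Φ t - rodAngle L X Φ s‖ ≤ √|t - s| * ‖hX.slope hL Φ‖ :=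
  norm_sub_le_sqrt_mul_norm finite_knotSet.countable hX.continuous_rodAngle
    (fun _ h => hX.hasDerivAt_rodAngle hL h) (hX.memLp_rodSlope hL) hs ht

/-- The unit tangents prescribed in the Hermite data fix the speed at the knots; this is the
discrete form of the arc length constraint. -/
theorem IsRod.rodVelocity_knot (hX : IsRod X) (hL : 0 < L) {i : ℕ} (h1 : 1 ≤ i) (h2 : i ≤ N) :
    rodVelocity L X (knot X i / stretch L X) = stretch L X • edgeDir X i := by
  rw [rodVelocity, mul_div_cancel₀ _ (hX.stretch_pos hL).ne']
  congr 1
  rcases h2.eq_or_lt with rfl | h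
  · rw [glue_eq_last hX.knot_strictMonoOn h1 (velocityPiece_match hX) le_rfl,
      velocityPiece_left h1 le_rfl]
  · rw [glue_eq_mid hX.knot_strictMonoOn (velocityPiece_match hX) h1 h le_rfl (hX.knot_lt h1 h).le,
      velocityPiece_left h1 h2]

theorem IsRod.knot_mem (hX : IsRod X) {i : ℕ} (h1 : 1 ≤ i) (h2 : i ≤ N) :
    knot X i ∈ Set.Icc 0 (polyLength X) := by
  have a := hX.edgeLength_pos le_rfl hX.1
  have b := hX.edgeLength_pos hX.1 le_rfl
  have c := hX.knot_strictMonoOn.monotoneOn ⟨le_rfl, hX.1⟩ ⟨h1, h2⟩ h1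
  have d := hX.knot_strictMonoOn.monotoneOn ⟨h1, h2⟩ ⟨hX.1, le_rfl⟩ h2
  have e := knot_one (X := X)
  have f := polyLength_sub_knot (X := X)
  constructor <;> linarith

theorem IsRod.rodCurve_knot (hX : IsRod X) (hL : 0 < L) {i : ℕ} (h1 : 1 ≤ i) (h2 : i ≤ N) :
    rodCurve L X (knot X i / stretch L X) = edgeMid X i := by
  rw [rodCurve, mul_div_cancel₀ _ (hX.stretch_pos hL).ne', splineCurve_eq_glue hX]
  rcases h2.eq_or_lt with rfl | h
  · rw [glue_eq_last hX.knot_strictMonoOn h1 (curvePiece_match hX) le_rfl,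
      curvePiece_left hX h1 le_rfl]
  · rw [glue_eq_mid hX.knot_strictMonoOn (curvePiece_match hX) h1 h le_rfl (hX.knot_lt h1 h).le,
      curvePiece_left hX h1 h2]

theorem IsRod.rodAngle_knot (hX : IsRod X) (hL : 0 < L) {i : ℕ} (h1 : 1 ≤ i) (h2 : i ≤ N) :
    rodAngle L X Φ (knot X i / stretch L X) = angle Φ i := by
  rw [rodAngle, mul_div_cancel₀ _ (hX.stretch_pos hL).ne', splineAngle_eq_glue hX]
  rcases h2.eq_or_lt with rfl | h
  · rw [glue_eq_last hX.knot_strictMonoOn h1 (anglePiece_match hX) le_rfl,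
      anglePiece, if_neg (by omega), if_pos le_rfl]
  · rw [glue_eq_mid hX.knot_strictMonoOn (anglePiece_match hX) h1 h le_rfl (hX.knot_lt h1 h).le,
      anglePiece, if_neg (by omega), if_neg (by omega), sub_self, mul_zero, add_zero]

theorem stretch_mul (hL : 0 < L) : stretch L X * L = polyLength X := div_mul_cancel₀ _ hL.ne'

theorem IsRod.knot_div_mem (hX : IsRod X) (hL : 0 < L) {i : ℕ} (h1 : 1 ≤ i) (h2 : i ≤ N) :
    knot X i / stretch L X ∈ Set.Icc 0 L := by
  have hl := hX.stretch_pos hL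
  have := hX.knot_mem h1 h2
  refine ⟨div_nonneg this.1 hl.le, (div_le_iff₀ hl).2 ?_⟩
  rw [mul_comm, stretch_mul hL]; exact this.2

/-- Every point of `[0, ℓ(X)]` is close to a knot. -/
theorem IsRod.exists_knot_near (hX : IsRod X) {m : ℝ} (hm : ∀ i ∈ Finset.Icc 1 N, edgeLength X i ≤ m)
    {τ : ℝ} (hτ : τ ∈ Set.Icc 0 (polyLength X)) :
    ∃ i, 1 ≤ i ∧ i ≤ N ∧ |τ - knot X i| ≤ m := by
  have a := hX.edgeLength_pos le_rfl hX.1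
  have b := hX.edgeLength_pos hX.1 le_rfl
  have a' := hm 1 (Finset.mem_Icc.2 ⟨le_rfl, hX.1⟩)
  have b' := hm N (Finset.mem_Icc.2 ⟨hX.1, le_rfl⟩)
  have e := knot_one (X := X)
  have f := polyLength_sub_knot (X := X)
  rcases le_or_gt τ (knot X 1) with h | h
  · exact ⟨1, le_rfl, hX.1, abs_le.2 ⟨by linarith [hτ.1], by linarith⟩⟩
  rcases le_or_gt (knot X N) τ with h' | h'
  · exact ⟨N, hX.1, le_rfl, abs_le.2 ⟨by linarith, by linarith [hτ.2]⟩⟩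
  obtain ⟨i, h1, h2, h3, h4⟩ := exists_mem_Ico_knot hX.1 h.le h'
  have c := hm i (Finset.mem_Icc.2 ⟨h1, h2.le⟩)
  have d := hm (i + 1) (Finset.mem_Icc.2 ⟨by omega, h2⟩)
  have g := knot_succ_sub (X := X) (i := i)
  exact ⟨i, h1, h2.le, abs_le.2 ⟨by linarith, by linarith⟩⟩

theorem IsRod.exists_knot_parameter_near (hX : IsRod X) (hL : 0 < L) {m : ℝ}
    (hm : ∀ i ∈ Finset.Icc 1 N, edgeLength X i ≤ m) {t : ℝ} (ht : t ∈ Set.Icc 0 L) :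
    ∃ i, 1 ≤ i ∧ i ≤ N ∧ |t - knot X i / stretch L X| ≤ m / stretch L X := by
  have hl := hX.stretch_pos hL
  obtain ⟨i, h1, h2, h3⟩ := hX.exists_knot_near hm (τ := stretch L X * t)
    ⟨mul_nonneg hl.le ht.1, by rw [← stretch_mul hL]; exact mul_le_mul_of_nonneg_left ht.2 hl.le⟩
  refine ⟨i, h1, h2, ?_⟩
  rw [le_div_iff₀ hl, ← abs_of_pos hl, ← abs_mul, abs_of_pos hl, sub_mul, div_mul_cancel₀ _ hl.ne',
    mul_comm t]
  exact h3

/-- The speed is exactly the stretch at a knot within distance m/λ, and the velocity is Hölder-1/2.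
-/
theorem IsRod.abs_norm_rodVelocity_sub_le (hX : IsRod X) (hL : 0 < L) {m : ℝ}
    (hm : ∀ i ∈ Finset.Icc 1 N, edgeLength X i ≤ m) {t : ℝ} (ht : t ∈ Set.Icc 0 L) :
    |‖rodVelocity L X t‖ - stretch L X| ≤ √(m / stretch L X) * ‖hX.accel hL‖ := by
  have hl := hX.stretch_pos hL
  obtain ⟨i, h1, h2, h3⟩ := hX.exists_knot_parameter_near hL hm ht
  have hs := hX.knot_div_mem hL h1 h2
  have hn : ‖rodVelocity L X (knot X i / stretch L X)‖ = stretch L X := by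
    rw [hX.rodVelocity_knot hL h1 h2, norm_smul, hX.norm_edgeDir h1 h2, mul_one,
      Real.norm_of_nonneg hl.le]
  have := (abs_norm_sub_norm_le _ _).trans (hX.norm_rodVelocity_sub_le hL hs ht)
  rw [hn] at this
  exact this.trans (mul_le_mul_of_nonneg_right (Real.sqrt_le_sqrt h3) (norm_nonneg _))

/-- The chord is compared with (t - s) times the velocity at s. The two errors are the oscillation
of the velocity on [s, t] and the defect of the speed at s; only values of the curve enter, so the
estimate passes to pointwise limits. -/
theorem IsRod.abs_dist_rodCurve_sub_le (hX : IsRod X) (hL : 0 < L) {m : ℝ}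
    (hm : ∀ i ∈ Finset.Icc 1 N, edgeLength X i ≤ m) {s t : ℝ} (hs : s ∈ Set.Icc 0 L)
    (ht : t ∈ Set.Icc 0 L) (hst : s ≤ t) :
    |‖rodCurve L X t - rodCurve L X s‖ - (t - s) * stretch L X|
      ≤ (t - s) * ((√(t - s) + √(m / stretch L X)) * ‖hX.accel hL‖) := by
  have h0 : 0 ≤ t - s := sub_nonneg.2 hst
  have e : rodCurve L X t - rodCurve L X s - (t - s) • rodVelocity L X s
      = ∫ r in s..t, (rodVelocity L X r - rodVelocity L X s) := by
    rw [intervalIntegral.integral_sub (hX.continuous_rodVelocity.intervalIntegrable _ _) (by simp),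
      intervalIntegral.integral_eq_sub_of_hasDerivAt (fun r _ => hX.hasDerivAt_rodCurve r)
        (hX.continuous_rodVelocity.intervalIntegrable _ _), intervalIntegral.integral_const]
  have h1 : ‖rodCurve L X t - rodCurve L X s - (t - s) • rodVelocity L X s‖
      ≤ √(t - s) * ‖hX.accel hL‖ * (t - s) := by
    rw [e, ← abs_of_nonneg h0]
    refine intervalIntegral.norm_integral_le_of_norm_le_const fun r hr => ?_
    rw [Set.uIoc_of_le hst] at hr
    refine (hX.norm_rodVelocity_sub_le hL hs ⟨hs.1.trans hr.1.le, hr.2.trans ht.2⟩).trans ?_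
    refine mul_le_mul_of_nonneg_right (Real.sqrt_le_sqrt ?_) (norm_nonneg _)
    rw [abs_of_nonneg (sub_nonneg.2 hr.1.le), abs_of_nonneg h0]
    linarith [hr.2]
  have h2 := hX.abs_norm_rodVelocity_sub_le hL hm hs
  have h3 := (abs_norm_sub_norm_le _ _).trans h1
  rw [norm_smul, Real.norm_of_nonneg h0] at h3
  calc _ = |(‖rodCurve L X t - rodCurve L X s‖ - (t - s) * ‖rodVelocity L X s‖)
        + (t - s) * (‖rodVelocity L X s‖ - stretch L X)| := by congr 1; ring
    _ ≤ _ := abs_add_le _ _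
    _ ≤ √(t - s) * ‖hX.accel hL‖ * (t - s)
        + (t - s) * (√(m / stretch L X) * ‖hX.accel hL‖) := by
      refine add_le_add h3 ?_
      rw [abs_mul, abs_of_nonneg h0]
      exact mul_le_mul_of_nonneg_left h2 h0
    _ = _ := by ring

end KirchhoffRod

/-! ### The liminf inequality. -/

namespace KirchhoffRod

variable {L : ℝ}

/-- A weakly differentiable function that is close to an isometry at small scales has a unit
derivative. -/
theorem HasWeakDeriv.ae_norm_eq_one {E : Type*} [NormedAddCommGroup E] [NormedSpace ℝ E]
    [CompleteSpace E] (hL : 0 < L) {u v : L2 L E} (h : HasWeakDeriv L u v) {M : ℝ} {S : Set ℝ}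
    (hS : ∀ᵐ t ∂(volume.restrict (Set.Ioo (0 : ℝ) L)), t ∈ S)
    (hu : ∀ s ∈ S, ∀ t ∈ S, s < t → |‖u t - u s‖ - (t - s)| ≤ (t - s) * (√(t - s) * M)) :
    ∀ᵐ t ∂(volume.restrict (Set.Ioo (0 : ℝ) L)), ‖v t‖ = 1 := by
  obtain ⟨c, hc⟩ := h.exists_ae_eq_primitive hL (integrableOn_of_L2 u) (integrableOn_of_L2 v)
  set F : ℝ → E := fun t => ∫ s in (0 : ℝ)..t, v s with hF
  have hvi : IntervalIntegrable v volume 0 L :=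
    intervalIntegrable_of_Ioo (integrableOn_of_L2 v) ⟨le_rfl, hL.le⟩ ⟨hL.le, le_rfl⟩
  have hd := hvi.ae_hasDerivAt_integral
  have hgood : ∀ᵐ t, t ∈ Set.Ioo 0 L → t ∈ S ∧ u t = c + F t :=
    (ae_restrict_iff' measurableSet_Ioo).1 (hS.and hc)
  have hdense := Measure.dense_of_ae hgood
  rw [ae_restrict_iff' measurableSet_Ioo]
  filter_upwards [hd, hgood] with t htd htg ht
  have hder : HasDerivAt F (v t) t :=
    htd (by rw [Set.uIcc_of_le hL.le]; exact Set.Ioo_subset_Icc_self ht) 0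
      (by rw [Set.uIcc_of_le hL.le]; exact ⟨le_rfl, hL.le⟩)
  obtain ⟨htS, htu⟩ := htg ht
  have hlim : Tendsto (fun s => |‖slope F t s‖ - 1| - √(s - t) * M) (𝓝[>] t)
      (𝓝 (|‖v t‖ - 1| - √(t - t) * M)) := by
    refine Tendsto.sub ?_ ?_
    · exact (((hasDerivAt_iff_tendsto_slope.1 hder).mono_left
        (nhdsWithin_mono _ fun s hs => ne_of_gt hs)).norm.sub_const 1).abs
    · have : Continuous fun s => √(s - t) * M := by fun_prop
      exact this.continuousWithinAt
  -- The chord bound holds only between good points. These have full measure, hence are dense and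
  -- accumulate at t from the right; since the slope converges, frequent validity suffices.
  have hfreq : ∃ᶠ s in 𝓝[>] t, |‖slope F t s‖ - 1| - √(s - t) * M ≤ 0 := by
    rw [(nhdsGT_basis t).frequently_iff]
    intro b hb
    obtain ⟨s, hs, hs1, hs2⟩ := hdense.exists_between (lt_min hb ht.2)
    refine ⟨s, ⟨hs1, hs2.trans_le (min_le_left _ _)⟩, ?_⟩
    obtain ⟨hsS, hsu⟩ := hs ⟨ht.1.trans hs1, hs2.trans_le (min_le_right _ _)⟩
    have hpos : 0 < s - t := sub_pos.2 hs1
    have hle := hu t htS s hsS hs1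
    rw [hsu, htu, add_sub_add_left_eq_sub] at hle
    have e : ‖F s - F t‖ = (s - t) * ‖slope F t s‖ := by
      rw [slope_def_module, norm_smul, norm_inv, Real.norm_of_nonneg hpos.le,
        mul_inv_cancel_left₀ hpos.ne']
    have e2 : (s - t) * ‖slope F t s‖ - (s - t) = (s - t) * (‖slope F t s‖ - 1) := by ring
    rw [e, e2, abs_mul, abs_of_pos hpos] at hle
    exact sub_nonpos.2 (le_of_mul_le_mul_left hle hpos)
  have := le_of_tendsto_of_frequently hlim hfreq
  rw [sub_self, Real.sqrt_zero, zero_mul, sub_zero] at this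
  exact sub_eq_zero.1 (abs_eq_zero.1 (le_antisymm this (abs_nonneg _)))

variable {α β : ℝ}

theorem edgeLength_le_iSup {N : ℕ} (X : Fin (N + 1) → E3) :
    ∀ i ∈ Finset.Icc 1 N, edgeLength X i ≤ ⨆ i : Fin N, edgeLength X (i + 1) := by
  intro i hi
  rw [Finset.mem_Icc] at hi
  have := le_ciSup (f := fun j : Fin N => edgeLength X (j + 1)) (Set.finite_range _).bddAbove
    ⟨i - 1, by omega⟩
  simpa [Nat.sub_add_cancel hi.1] using this

theorem iSup_edgeLength_nonneg {N : ℕ} (X : Fin (N + 1) → E3) :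
    0 ≤ ⨆ i : Fin N, edgeLength X (i + 1) := Real.iSup_nonneg fun _ => edgeLength_nonneg _

theorem penalty_nonneg {N : ℕ} (X : Fin (N + 1) → E3) : 0 ≤ penalty L α β X :=
  add_nonneg (by positivity) (mul_nonneg (by positivity) (iSup_edgeLength_nonneg X))

theorem IsRod.bounds_of_rodEnergy_lt {N : ℕ} {X : Fin (N + 1) → E3} {Φ : Fin N → ℝ}
    (hX : IsRod X) (hL : 0 < L) {c : ℝ} (h : rodEnergy L α β X Φ < ENNReal.ofReal c) :
    ‖hX.accel hL‖ ^ 2 + ‖hX.slope hL Φ‖ ^ 2 ≤ c ∧ |stretch L X - 1| ≤ c * (N : ℝ) ^ (-α) ∧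
      (⨆ i : Fin N, edgeLength X (i + 1)) ≤ c * (N : ℝ) ^ (-β) := by
  have hp := penalty_nonneg (L := L) (α := α) (β := β) X
  rw [rodEnergy, hX.bendEnergy_eq_norm hL, hX.torEnergy_eq_norm hL,
    ← ENNReal.ofReal_add (by positivity) (by positivity),
    ← ENNReal.ofReal_add (by positivity) hp, ENNReal.ofReal_lt_ofReal_iff'] at h
  have h1 := h.1.le
  have hN : (0 : ℝ) < N := by exact_mod_cast hX.1
  have ha : 0 < (N : ℝ) ^ α := by positivity
  have hb : 0 < (N : ℝ) ^ β := by positivity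
  have p1 : 0 ≤ (N : ℝ) ^ α * |stretch L X - 1| := by positivity
  have p2 := mul_nonneg hb.le (iSup_edgeLength_nonneg X)
  have s1 := sq_nonneg ‖hX.accel hL‖
  have s2 := sq_nonneg ‖hX.slope hL Φ‖
  rw [penalty] at h1
  refine ⟨by linarith, ?_, ?_⟩
  · rw [Real.rpow_neg hN.le, ← div_eq_mul_inv, le_div_iff₀ ha, mul_comm]; linarith
  · rw [Real.rpow_neg hN.le, ← div_eq_mul_inv, le_div_iff₀ hb, mul_comm]; linarith

open scoped InnerProductSpace in
-- The compactness core. Numbers of edges run through `ns`, and the curves converge a.e., because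
-- the caller has already extracted subsequences.
theorem kirchhoffEnergy_le_of_seq (hL : 0 < L) (hα : 0 < α) (hβ : 0 < β) {ns : ℕ → ℕ}
    (hns : Tendsto ns atTop atTop) {p : L2 L E3 × L2 L ℝ} {q : ℕ → L2 L E3 × L2 L ℝ}
    (hq : Tendsto q atTop (𝓝 p))
    (hae : ∀ᵐ t ∂(volume.restrict (Set.Ioo (0 : ℝ) L)),
      Tendsto (fun k => (q k).1 t) atTop (𝓝 (p.1 t)))
    (X : ∀ k, Fin (ns k + 1) → E3) (Φ : ∀ k, Fin (ns k) → ℝ)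
    (hr : ∀ k, Represents L (X k) (Φ k) (q k)) {c : ℝ}
    (hE : ∀ k, rodEnergy L α β (X k) (Φ k) < ENNReal.ofReal c) :
    kirchhoffEnergy L p ≤ ENNReal.ofReal c := by
  set lam : ℕ → ℝ := fun k => stretch L (X k)
  set m : ℕ → ℝ := fun k => ⨆ i : Fin (ns k), edgeLength (X k) (i + 1)
  have hb := fun k => (hr k).1.bounds_of_rodEnergy_lt hL (hE k)
  have hpow : ∀ {γ : ℝ}, 0 < γ → Tendsto (fun k => c * (ns k : ℝ) ^ (-γ)) atTop (𝓝 0) := by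
    intro γ hγ
    simpa using (((tendsto_rpow_neg_atTop hγ).comp
      (tendsto_natCast_atTop_atTop.comp hns)).const_mul c)
  have hlam : Tendsto lam atTop (𝓝 1) := by
    have := squeeze_zero (fun k => abs_nonneg _) (fun k => (hb k).2.1) (hpow hα)
    exact tendsto_iff_dist_tendsto_zero.2 this
  have hm : Tendsto m atTop (𝓝 0) :=
    squeeze_zero (fun k => iSup_edgeLength_nonneg _) (fun k => (hb k).2.2) (hpow hβ)
  have hratio : Tendsto (fun k => √(m k / lam k)) atTop (𝓝 0) := by
    have := (hm.div hlam one_ne_zero).sqrt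
    simpa using this
  have hc : 0 ≤ c := le_trans (by positivity) (hb 0).1
  have ha : ∀ k, ‖(hr k).1.accel hL‖ ≤ √c := fun k =>
    Real.le_sqrt_of_sq_le (by nlinarith [(hb k).1, sq_nonneg ‖(hr k).1.slope hL (Φ k)‖])
  have hs : ∀ k, ‖(hr k).1.slope hL (Φ k)‖ ≤ √c := fun k =>
    Real.le_sqrt_of_sq_le (by nlinarith [(hb k).1, sq_nonneg ‖(hr k).1.accel hL‖])
  -- Once λ < 2 and √(m/λ) < 1 the speed is below 2 + √c; the first factor is the square root of the
  -- measure of the interval.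
  have hv : ∃ C, ∀ᶠ k in atTop, ‖(hr k).1.velocity L‖ ≤ C := by
    refine ⟨((volume.restrict (Set.Ioo (0 : ℝ) L)).real Set.univ) ^ ((2 : ℝ≥0∞).toReal⁻¹)
      * (2 + 1 * √c), ?_⟩
    filter_upwards [hlam.eventually (gt_mem_nhds (by norm_num : (1 : ℝ) < 2)),
      hratio.eventually (gt_mem_nhds (by norm_num : (0 : ℝ) < 1))] with k h1 h2
    refine Lp.norm_le_of_ae_bound (by positivity) ?_
    filter_upwards [MemLp.coeFn_toLp (memLp_of_continuous (L := L) (hr k).1.continuous_rodVelocity),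
      ae_restrict_mem measurableSet_Ioo] with t ht ht'
    rw [IsRod.velocity, ht]
    have := (abs_le.1 ((hr k).1.abs_norm_rodVelocity_sub_le hL (edgeLength_le_iSup (X k))
      (Set.Ioo_subset_Icc_self ht'))).2
    have h3 : √(m k / lam k) * ‖(hr k).1.accel hL‖ ≤ 1 * √c :=
      mul_le_mul h2.le (ha k) (norm_nonneg _) zero_le_one
    change _ ≤ √(m k / lam k) * _ at this
    change stretch L (X k) < 2 at h1
    linarith
  let U : Ultrafilter ℕ := Ultrafilter.of atTop
  have hU : (U : Filter ℕ) ≤ atTop := Ultrafilter.of_le atTop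
  obtain ⟨C, hv⟩ := hv
  obtain ⟨v₀, hv₀⟩ := exists_weak_limit U (hv.filter_mono hU)
  obtain ⟨a₀, ha₀⟩ := exists_weak_limit U (Eventually.of_forall ha)
  obtain ⟨b₀, hb₀⟩ := exists_weak_limit U (Eventually.of_forall hs)
  have w1 : HasWeakDeriv L p.1 v₀ := HasWeakDeriv.of_weak_limit (l := U)
    (fun k => (hr k).hasWeakDeriv_fst hL)
    (fun h => (((continuous_fst.tendsto _).comp hq).mono_left hU).inner tendsto_const_nhds) hv₀
  have w2 : HasWeakDeriv L v₀ a₀ := HasWeakDeriv.of_weak_limit (l := U)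
    (fun k => (hr k).1.hasWeakDeriv_velocity hL) hv₀ ha₀
  have w3 : HasWeakDeriv L p.2 b₀ := HasWeakDeriv.of_weak_limit (l := U)
    (fun k => (hr k).hasWeakDeriv_snd hL)
    (fun h => (((continuous_snd.tendsto _).comp hq).mono_left hU).inner tendsto_const_nhds) hb₀
  have e1 : weakDeriv p.1 = v₀ := w1.weakDeriv_eq
  have e2 : weakDeriv v₀ = a₀ := w2.weakDeriv_eq
  have e3 : weakDeriv p.2 = b₀ := w3.weakDeriv_eq
  -- Unit speed comes from the a.e. convergence of the curves, not from the weak limit of the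
  -- velocities: as λ → 1 and m/λ → 0, the chord bound passes to the limit.
  have hone : ∀ᵐ t ∂(volume.restrict (Set.Ioo (0 : ℝ) L)), ‖v₀ t‖ = 1 := by
    refine w1.ae_norm_eq_one hL (M := √c)
      (S := {t | t ∈ Set.Ioo 0 L ∧ Tendsto (fun k => rodCurve L (X k) t) atTop (𝓝 (p.1 t))}) ?_ ?_
    · have hall := ae_all_iff.2 fun k => (hr k).2.1
      filter_upwards [hae, ae_restrict_mem measurableSet_Ioo, hall] with t h1 h2 h3
      exact ⟨h2, h1.congr fun k => h3 k⟩
    · rintro s ⟨hs1, hs2⟩ t ⟨ht1, ht2⟩ hst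
      have l1 : Tendsto (fun k => |‖rodCurve L (X k) t - rodCurve L (X k) s‖ - (t - s) * lam k|)
          atTop (𝓝 |‖p.1 t - p.1 s‖ - (t - s) * 1|) :=
        ((ht2.sub hs2).norm.sub (hlam.const_mul _)).abs
      have l2 : Tendsto (fun k => (t - s) * ((√(t - s) + √(m k / lam k)) * √c)) atTop
          (𝓝 ((t - s) * ((√(t - s) + 0) * √c))) :=
        ((hratio.const_add _).mul_const _).const_mul _
      rw [mul_one] at l1
      rw [add_zero] at l2
      refine le_of_tendsto_of_tendsto' l1 l2 fun k => ?_
      refine ((hr k).1.abs_dist_rodCurve_sub_le hL (edgeLength_le_iSup (X k))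
        (Set.Ioo_subset_Icc_self hs1) (Set.Ioo_subset_Icc_self ht1) hst.le).trans ?_
      refine mul_le_mul_of_nonneg_left (mul_le_mul_of_nonneg_left (ha k) (by positivity))
        (sub_nonneg.2 hst.le)
  -- Joint lower semicontinuity: test the weak limits against `a₀` and `b₀` themselves and use xy ≤
  -- (x² + y²)/2.
  have hle : ‖a₀‖ ^ 2 + ‖b₀‖ ^ 2 ≤ c := by
    have hl := (ha₀ a₀).add (hb₀ b₀)
    have := le_of_tendsto hl (b := (c + (‖a₀‖ ^ 2 + ‖b₀‖ ^ 2)) / 2) (Eventually.of_forall fun k => by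
      have i1 := real_inner_le_norm ((hr k).1.accel hL) a₀
      have i2 := real_inner_le_norm ((hr k).1.slope hL (Φ k)) b₀
      have i3 := (hb k).1
      nlinarith [sq_nonneg (‖(hr k).1.accel hL‖ - ‖a₀‖),
        sq_nonneg (‖(hr k).1.slope hL (Φ k)‖ - ‖b₀‖)])
    rw [real_inner_self_eq_norm_sq, real_inner_self_eq_norm_sq] at this
    linarith
  rw [kirchhoffEnergy, if_pos ⟨⟨⟨v₀, w1⟩, by rw [e1]; exact ⟨a₀, w2⟩⟩, ⟨b₀, w3⟩, by rwa [e1]⟩,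
    e1, e2, e3, lintegral_add_left' ((Lp.aestronglyMeasurable a₀).enorm.pow_const 2),
    lintegral_enorm_sq, lintegral_enorm_sq, ← ENNReal.ofReal_add (by positivity) (by positivity)]
  exact ENNReal.ofReal_le_ofReal hle

/-- It suffices to treat each c above the liminf. Infinitely many N then have energy below c, and
since that inequality is strict, the infimum yields actual rods below c. -/
theorem kirchhoffEnergy_le_liminf (hL : 0 < L) (hα : 0 < α) (hβ : 0 < β)
    (p : L2 L E3 × L2 L ℝ) (q : ℕ → L2 L E3 × L2 L ℝ) (hq : Tendsto q atTop (𝓝 p)) :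
    kirchhoffEnergy L p ≤ liminf (fun N => discreteEnergy L α β N (q N)) atTop := by
  refine le_of_forall_gt_imp_ge_of_dense fun c hc => ?_
  rcases eq_or_ne c ⊤ with rfl | hct
  · exact le_top
  obtain ⟨ns, hns, hlt⟩ := extraction_of_frequently_atTop (frequently_lt_of_liminf_lt (by isBoundedDefault) hc)
  have hq1 : Tendsto (fun k => q (ns k)) atTop (𝓝 p) := hq.comp hns.tendsto_atTop
  -- L² convergence gives convergence in measure, hence an a.e. convergent subsequence of curves.
  obtain ⟨ms, hms, hae⟩ := (tendstoInMeasure_of_tendsto_Lp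
    ((continuous_fst.tendsto _).comp hq1)).exists_seq_tendsto_ae
  have hex : ∀ k, ∃ (X : Fin (ns (ms k) + 1) → E3) (Φ : Fin (ns (ms k)) → ℝ),
      Represents L X Φ (q (ns (ms k))) ∧ rodEnergy L α β X Φ < ENNReal.ofReal c.toReal := by
    intro k
    have h := hlt (ms k)
    rw [discreteEnergy] at h
    simp only [iInf_lt_iff] at h
    obtain ⟨X, Φ, h1, h2⟩ := h
    exact ⟨X, Φ, h1, by rwa [ENNReal.ofReal_toReal hct]⟩
  choose X Φ hr hE using hex
  have := kirchhoffEnergy_le_of_seq hL hα hβ (ns := fun k => ns (ms k))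
    (hns.tendsto_atTop.comp hms.tendsto_atTop) (hq1.comp hms.tendsto_atTop) hae X Φ hr hE
  rwa [ENNReal.ofReal_toReal hct] at this

end KirchhoffRod

/-! ### Energy bounds for rods with almost equal edges. -/

namespace KirchhoffRod

variable {N : ℕ} {L : ℝ}

/-- The integrand is dominated by a step function on the cells (k i/lam, k (i+1)/lam], half-open as
in `glue`; the end pieces vanish, so nothing is lost by integrating over the whole line. -/
theorem lintegral_glue_le {E : Type*} [NormedAddCommGroup E] [NormedSpace ℝ E] {k : ℕ → ℝ}
    {P : ℕ → ℝ → E} {lam c : ℝ} {B : ℕ → ℝ} (hk : StrictMonoOn k (Set.Icc 1 N)) (hN : 1 ≤ N)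
    (hlam : 0 < lam) (h0 : ∀ τ, P 0 τ = 0) (hlast : ∀ τ, P N τ = 0)
    (hB : ∀ i, 1 ≤ i → i < N → ∀ τ, k i ≤ τ → τ ≤ k (i + 1) → ‖c • P i τ‖ ≤ B i) :
    ∫⁻ t in Set.Ioo (0 : ℝ) L, ‖c • glue k P N (lam * t)‖ₑ ^ 2
      ≤ ENNReal.ofReal (∑ i ∈ Finset.Ico 1 N, B i ^ 2 * ((k (i + 1) - k i) / lam)) := by
  have hkl : ∀ i ∈ Finset.Ico 1 N, k i < k (i + 1) := fun i hi => by
    rw [Finset.mem_Ico] at hi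
    exact hk ⟨hi.1, hi.2.le⟩ ⟨by omega, hi.2⟩ (by omega)
  have hpt : ∀ t : ℝ, ‖c • glue k P N (lam * t)‖ₑ ^ 2 ≤ ∑ i ∈ Finset.Ico 1 N,
      (Set.Ioc (k i / lam) (k (i + 1) / lam)).indicator (fun _ => ENNReal.ofReal (B i ^ 2)) t := by
    intro t
    rcases le_or_gt (lam * t) (k 1) with h1 | h1
    · rw [glue_eq_before hk h1, h0]; simp
    rcases lt_or_ge (k N) (lam * t) with h2 | h2
    · rw [glue_eq_last_of_lt (Or.inr h2), hlast]; simp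
    obtain ⟨i, hi, hiN, ha, hb⟩ := exists_mem_Ioc_knot hN h1 h2
    have hmem : t ∈ Set.Ioc (k i / lam) (k (i + 1) / lam) :=
      ⟨(div_lt_iff₀' hlam).2 ha, (le_div_iff₀' hlam).2 hb⟩
    refine le_trans ?_ (Finset.single_le_sum (f := fun i =>
      (Set.Ioc (k i / lam) (k (i + 1) / lam)).indicator (fun _ => ENNReal.ofReal (B i ^ 2)) t)
      (fun _ _ => zero_le) (Finset.mem_Ico.2 ⟨hi, hiN⟩))
    rw [Set.indicator_of_mem hmem, glue_eq_mid_of_lt hk hi hiN ha hb, ← ofReal_norm,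
      ← ENNReal.ofReal_pow (norm_nonneg _)]
    exact ENNReal.ofReal_le_ofReal (pow_le_pow_left₀ (norm_nonneg _) (hB i hi hiN _ ha.le hb) 2)
  calc _ ≤ ∫⁻ t, ‖c • glue k P N (lam * t)‖ₑ ^ 2 := setLIntegral_le_lintegral _ _
    _ ≤ ∫⁻ t, ∑ i ∈ Finset.Ico 1 N,
      (Set.Ioc (k i / lam) (k (i + 1) / lam)).indicator (fun _ => ENNReal.ofReal (B i ^ 2)) t :=
        lintegral_mono hpt
    _ = _ := by
      rw [lintegral_finsetSum _ fun i _ => measurable_const.indicator measurableSet_Ioc,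
        ENNReal.ofReal_sum_of_nonneg fun i hi => mul_nonneg (sq_nonneg _)
          (div_nonneg (sub_nonneg.2 (hkl i hi).le) hlam.le)]
      refine Finset.sum_congr rfl fun i hi => ?_
      rw [lintegral_indicator_const measurableSet_Ioc, Real.volume_Ioc, ← sub_div,
        ← ENNReal.ofReal_mul (sq_nonneg _)]

/-- All edges have almost the length `h`. -/
structure NearUniform (X : Fin (N + 1) → E3) (h δ : ℝ) : Prop where
  pos : 0 < h
  nonneg : 0 ≤ δ
  le_half : δ ≤ 1 / 2
  lower : ∀ i, 1 ≤ i → i ≤ N → h * (1 - δ) ≤ edgeLength X i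
  upper : ∀ i, 1 ≤ i → i ≤ N → edgeLength X i ≤ h

variable {X : Fin (N + 1) → E3} {Φ : Fin N → ℝ} {h δ : ℝ}

theorem NearUniform.isRod (hu : NearUniform X h δ) (hN : 0 < N) : IsRod X := by
  refine ⟨hN, fun i hi he => ?_⟩
  rw [Finset.mem_Icc] at hi
  have h1 := hu.lower i hi.1 hi.2
  rw [edgeLength, he, sub_self, norm_zero] at h1
  have := mul_pos hu.pos (by linarith [hu.le_half] : 0 < 1 - δ)
  linarith

theorem NearUniform.stretch_bounds (hu : NearUniform X h δ) (hL : 0 < L) (hh : N * h = L) :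
    1 - δ ≤ stretch L X ∧ stretch L X ≤ 1 := by
  have a : (N : ℝ) * (h * (1 - δ)) ≤ polyLength X := by
    have := Finset.card_nsmul_le_sum (Finset.Icc 1 N) (edgeLength X) (h * (1 - δ))
      fun i hi => hu.lower i (Finset.mem_Icc.1 hi).1 (Finset.mem_Icc.1 hi).2
    simpa [polyLength] using this
  have b : polyLength X ≤ N * h := by
    have := Finset.sum_le_card_nsmul (Finset.Icc 1 N) (edgeLength X) h
      fun i hi => hu.upper i (Finset.mem_Icc.1 hi).1 (Finset.mem_Icc.1 hi).2
    simpa [polyLength] using this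
  rw [stretch, le_div_iff₀ hL, div_le_one hL]
  refine ⟨?_, by rwa [← hh]⟩
  rw [← hh]
  calc _ = (N : ℝ) * (h * (1 - δ)) := by ring
    _ ≤ _ := a

theorem NearUniform.knot_sub (hu : NearUniform X h δ) {i : ℕ} (h1 : 1 ≤ i) (h2 : i < N) :
    h * (1 - δ) ≤ knot X (i + 1) - knot X i := by
  rw [knot_succ_sub]
  have a := hu.lower i h1 h2.le
  have b := hu.lower (i + 1) (by omega) h2
  linarith

theorem NearUniform.norm_accelPiece_le (hu : NearUniform X h δ) (hX : IsRod X) {i : ℕ} (h1 : 1 ≤ i)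
    (h2 : i < N) {τ : ℝ} (ha : knot X i ≤ τ) (hb : τ ≤ knot X (i + 1)) :
    ‖accelPiece X i τ‖ ≤ (knot X (i + 1) - knot X i)⁻¹ * (1 + 3 * δ)
      * ‖edgeDir X (i + 1) - edgeDir X i‖ := by
  rw [accelPiece, if_neg (by omega), if_neg (by omega), norm_smul]
  refine mul_le_mul_of_nonneg_right ?_ (norm_nonneg _)
  have hT : 0 < knot X (i + 1) - knot X i := sub_pos.2 (hX.knot_lt h1 h2)
  have l1 := hu.lower i h1 h2.le
  have l2 := hu.lower (i + 1) (by omega) h2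
  have u1 := hu.upper i h1 h2.le
  have u2 := hu.upper (i + 1) (by omega) h2
  have hp := hX.edgeLength_pos h1 h2.le
  have hp' := hX.edgeLength_pos (i := i + 1) (by omega) h2
  have hr : |(edgeLength X i - edgeLength X (i + 1)) / (edgeLength X i + edgeLength X (i + 1))|
      ≤ δ := by
    rw [abs_div, abs_of_pos (add_pos hp hp'), div_le_iff₀ (add_pos hp hp')]
    have hh := hu.pos
    -- Since δ ≤ 1/2, two edges have total length at least 2h(1 - δ) ≥ h, while they differ by at
    -- most hδ.
    have h3 : δ * h ≤ δ * (edgeLength X i + edgeLength X (i + 1)) :=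
      mul_le_mul_of_nonneg_left (by nlinarith [hu.le_half]) hu.nonneg
    exact abs_le.2 ⟨by linarith, by linarith⟩
  have hs : |2 * (τ - knot X i) / (knot X (i + 1) - knot X i) - 1| ≤ 1 := by
    rw [abs_le]
    constructor
    · have : 0 ≤ 2 * (τ - knot X i) / (knot X (i + 1) - knot X i) :=
        div_nonneg (by linarith) hT.le
      linarith
    · rw [sub_le_iff_le_add, div_le_iff₀ hT]; linarith
  rw [norm_mul, norm_inv, Real.norm_of_nonneg hT.le]
  refine mul_le_mul_of_nonneg_left ((norm_add_le _ _).trans ?_) (inv_nonneg.2 hT.le)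
  rw [norm_one, norm_mul, norm_mul, Real.norm_eq_abs, Real.norm_eq_abs, Real.norm_eq_abs,
    abs_of_pos (by norm_num : (0 : ℝ) < 3)]
  have := mul_le_mul hr hs (abs_nonneg _) hu.nonneg
  linarith

/-- The chain-rule factor λ² is dropped since λ ≤ 1. A cell of length T/λ contributes T⁻² · T/λ, and
T ≥ h(1 - δ), λ ≥ 1 - δ give the denominator h(1 - δ)². -/
theorem NearUniform.bendEnergy_le (hu : NearUniform X h δ) (hN : 0 < N) (hL : 0 < L)
    (hh : N * h = L) {S : ℝ}
    (hS : ∑ i ∈ Finset.Ico 1 N, ‖edgeDir X (i + 1) - edgeDir X i‖ ^ 2 ≤ S) :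
    bendEnergy L X ≤ ENNReal.ofReal ((1 + 3 * δ) ^ 2 / (1 - δ) ^ 2 * (S / h)) := by
  have hX := hu.isRod hN
  have hl := hX.stretch_pos hL
  obtain ⟨sl, su⟩ := hu.stretch_bounds hL hh
  have hδ : 0 < 1 - δ := by linarith [hu.le_half]
  rw [hX.bendEnergy_eq hL]
  have e : ∀ t, rodAccel L X t
      = (stretch L X * stretch L X) • glue (knot X) (accelPiece X) N (stretch L X * t) := fun t => by
    rw [rodAccel, smul_smul]
  simp only [e]
  refine (lintegral_glue_le hX.knot_strictMonoOn hN hl (fun τ => by simp [accelPiece])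
    (fun τ => by simp [accelPiece]) (B := fun i => (knot X (i + 1) - knot X i)⁻¹ * (1 + 3 * δ)
      * ‖edgeDir X (i + 1) - edgeDir X i‖) ?_).trans (ENNReal.ofReal_le_ofReal ?_)
  · intro i h1 h2 τ ha hb
    rw [norm_smul, Real.norm_of_nonneg (by positivity)]
    refine le_trans ?_ (hu.norm_accelPiece_le hX h1 h2 ha hb)
    exact mul_le_of_le_one_left (norm_nonneg _) (mul_le_one₀ su hl.le su)
  · calc _ ≤ ∑ i ∈ Finset.Ico 1 N, (1 + 3 * δ) ^ 2 / (1 - δ) ^ 2 / h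
          * ‖edgeDir X (i + 1) - edgeDir X i‖ ^ 2 := by
          refine Finset.sum_le_sum fun i hi => ?_
          rw [Finset.mem_Ico] at hi
          have hT := hu.knot_sub hi.1 hi.2
          have hT0 : 0 < knot X (i + 1) - knot X i := sub_pos.2 (hX.knot_lt hi.1 hi.2)
          generalize knot X (i + 1) - knot X i = T at *
          generalize ‖edgeDir X (i + 1) - edgeDir X i‖ = d
          have e : (T⁻¹ * (1 + 3 * δ) * d) ^ 2 * (T / stretch L X)
              = (1 + 3 * δ) ^ 2 * d ^ 2 / (T * stretch L X) := by field_simp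
          have e' : (1 + 3 * δ) ^ 2 / (1 - δ) ^ 2 / h * d ^ 2
              = (1 + 3 * δ) ^ 2 * d ^ 2 / (h * (1 - δ) * (1 - δ)) := by field_simp
          rw [e, e']
          have hh := hu.pos
          refine div_le_div_of_nonneg_left (by positivity) (by positivity) ?_
          exact mul_le_mul hT sl hδ.le hT0.le
      _ ≤ _ := by
          rw [← Finset.mul_sum]
          have hh := hu.pos
          calc _ ≤ (1 + 3 * δ) ^ 2 / (1 - δ) ^ 2 / h * S :=
                mul_le_mul_of_nonneg_left hS (by positivity)
            _ = _ := by ring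

theorem NearUniform.torEnergy_le (hu : NearUniform X h δ) (hN : 0 < N) (hL : 0 < L)
    (hh : N * h = L) {S : ℝ}
    (hS : ∑ i ∈ Finset.Ico 1 N, ‖angle Φ (i + 1) - angle Φ i‖ ^ 2 ≤ S) :
    torEnergy L X Φ ≤ ENNReal.ofReal (1 / (1 - δ) ^ 2 * (S / h)) := by
  have hX := hu.isRod hN
  have hl := hX.stretch_pos hL
  obtain ⟨sl, su⟩ := hu.stretch_bounds hL hh
  have hδ : 0 < 1 - δ := by linarith [hu.le_half]
  rw [hX.torEnergy_eq hL]
  refine (lintegral_glue_le hX.knot_strictMonoOn hN hl (fun τ => by simp [slopePiece])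
    (fun τ => by simp [slopePiece]) (B := fun i => (knot X (i + 1) - knot X i)⁻¹
      * ‖angle Φ (i + 1) - angle Φ i‖) ?_).trans (ENNReal.ofReal_le_ofReal ?_)
  · intro i h1 h2 τ ha hb
    have hT0 : 0 < knot X (i + 1) - knot X i := sub_pos.2 (hX.knot_lt h1 h2)
    rw [norm_smul, Real.norm_of_nonneg hl.le, slopePiece, if_neg (by omega), if_neg (by omega),
      norm_div, Real.norm_of_nonneg hT0.le, div_eq_inv_mul]
    exact mul_le_of_le_one_left (by positivity) su
  · calc _ ≤ ∑ i ∈ Finset.Ico 1 N, 1 / (1 - δ) ^ 2 / h * ‖angle Φ (i + 1) - angle Φ i‖ ^ 2 := by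
          refine Finset.sum_le_sum fun i hi => ?_
          rw [Finset.mem_Ico] at hi
          have hT := hu.knot_sub hi.1 hi.2
          have hT0 : 0 < knot X (i + 1) - knot X i := sub_pos.2 (hX.knot_lt hi.1 hi.2)
          generalize knot X (i + 1) - knot X i = T at *
          generalize ‖angle Φ (i + 1) - angle Φ i‖ = d
          have e : (T⁻¹ * d) ^ 2 * (T / stretch L X) = d ^ 2 / (T * stretch L X) := by field_simp
          have e' : 1 / (1 - δ) ^ 2 / h * d ^ 2 = d ^ 2 / (h * (1 - δ) * (1 - δ)) := by field_simp
          rw [e, e']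
          have hh := hu.pos
          refine div_le_div_of_nonneg_left (by positivity) (by positivity) ?_
          exact mul_le_mul hT sl hδ.le hT0.le
      _ ≤ _ := by
          rw [← Finset.mul_sum]
          have hh := hu.pos
          calc _ ≤ 1 / (1 - δ) ^ 2 / h * S := mul_le_mul_of_nonneg_left hS (by positivity)
            _ = _ := by ring

/-- The knots stay close to the uniform grid. -/
theorem NearUniform.exists_grid_near (hu : NearUniform X h δ) (hN : 0 < N) (hL : 0 < L)
    (hh : N * h = L) {t : ℝ} (ht : t ∈ Set.Icc 0 L) :
    ∃ i, 1 ≤ i ∧ i ≤ N ∧ |t - knot X i / stretch L X| ≤ 2 * h ∧ |t - i * h| ≤ 3 * h + 2 * L * δ := by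
  have hX := hu.isRod hN
  have hl := hX.stretch_pos hL
  obtain ⟨sl, su⟩ := hu.stretch_bounds hL hh
  have hpos := hu.pos
  obtain ⟨i, h1, h2, h3⟩ := hX.exists_knot_parameter_near hL
    (fun i hi => hu.upper i (Finset.mem_Icc.1 hi).1 (Finset.mem_Icc.1 hi).2) ht
  have h4 : |t - knot X i / stretch L X| ≤ 2 * h := by
    refine h3.trans ?_
    rw [div_le_iff₀ hl]
    nlinarith [hu.le_half]
  refine ⟨i, h1, h2, h4, ?_⟩
  have hsum1 : (i : ℝ) * (h * (1 - δ)) ≤ ∑ k ∈ Finset.Icc 1 i, edgeLength X k := by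
    have := Finset.card_nsmul_le_sum (Finset.Icc 1 i) (edgeLength X) (h * (1 - δ))
      fun j hj => hu.lower j (Finset.mem_Icc.1 hj).1 ((Finset.mem_Icc.1 hj).2.trans h2)
    simpa using this
  have hsum2 : ∑ k ∈ Finset.Icc 1 i, edgeLength X k ≤ i * h := by
    have := Finset.sum_le_card_nsmul (Finset.Icc 1 i) (edgeLength X) h
      fun j hj => hu.upper j (Finset.mem_Icc.1 hj).1 ((Finset.mem_Icc.1 hj).2.trans h2)
    simpa using this
  have hi : (i : ℝ) * h ≤ L := by
    rw [← hh]; gcongr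
  -- The knot lies half an edge before the i-th vertex, and the accumulated shortfall of i edges is
  -- at most ihδ ≤ Lδ. Dividing by λ moves it by at most another Lδ.
  have hk : |knot X i - i * h| ≤ h + L * δ := by
    have a := hu.upper i h1 h2
    have b := edgeLength_nonneg (X := X) i
    have hid : (i : ℝ) * h * δ ≤ L * δ := mul_le_mul_of_nonneg_right hi hu.nonneg
    have hLd : 0 ≤ L * δ := mul_nonneg hL.le hu.nonneg
    have e : (i : ℝ) * (h * (1 - δ)) = i * h - i * h * δ := by ring
    rw [knot, abs_le]
    constructor <;> linarith
  have hk2 : |knot X i / stretch L X - knot X i| ≤ L * δ := by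
    have hm := hX.knot_div_mem hL h1 h2
    have e : knot X i / stretch L X - knot X i
        = knot X i / stretch L X * (1 - stretch L X) := by field_simp
    rw [e, abs_of_nonneg (mul_nonneg hm.1 (by linarith))]
    exact mul_le_mul hm.2 (by linarith) (by linarith) hL.le
  have e : t - i * h = (t - knot X i / stretch L X) + (knot X i / stretch L X - knot X i)
      + (knot X i - i * h) := by ring
  rw [e]
  refine (abs_add_three _ _ _).trans ?_
  linarith

end KirchhoffRod

/-! ### Sampling a unit-speed curve on a uniform grid. -/

namespace KirchhoffRod

open scoped InnerProductSpace in
-- After multiplication by ‖x‖‖y‖ the left side is exactly ‖x - y‖² - (‖x‖ - ‖y‖)².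
theorem sq_norm_normalize_sub_le {E : Type*} [NormedAddCommGroup E] [InnerProductSpace ℝ E]
    {x y : E} (hx : x ≠ 0) (hy : y ≠ 0) :
    ‖‖x‖⁻¹ • x - ‖y‖⁻¹ • y‖ ^ 2 ≤ ‖x - y‖ ^ 2 / (‖x‖ * ‖y‖) := by
  have hx' : 0 < ‖x‖ := norm_pos_iff.2 hx
  have hy' : 0 < ‖y‖ := norm_pos_iff.2 hy
  have hn : ∀ {z : E}, 0 < ‖z‖ → ‖‖z‖⁻¹ • z‖ = 1 := fun hz => by
    rw [norm_smul, norm_inv, norm_norm, inv_mul_cancel₀ hz.ne']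
  rw [norm_sub_sq_real, norm_sub_sq_real, hn hx', hn hy', real_inner_smul_left, real_inner_smul_right, le_div_iff₀ (mul_pos hx' hy')]
  have e : (1 ^ 2 - 2 * (‖x‖⁻¹ * (‖y‖⁻¹ * ⟪x, y⟫_ℝ)) + 1 ^ 2) * (‖x‖ * ‖y‖)
      = 2 * (‖x‖ * ‖y‖) - 2 * ⟪x, y⟫_ℝ := by field_simp; ring
  rw [e]
  nlinarith [sq_nonneg (‖x‖ - ‖y‖)]

/-- A unit speed curve `U` with derivatives `V`, `a`, and a function `Θ` with derivative `b`. -/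
structure Profile (L : ℝ) (a : L2 L E3) (b : L2 L ℝ) (V U : ℝ → E3) (Θ : ℝ → ℝ) : Prop where
  pos : 0 < L
  continuousOn_velocity : ContinuousOn V (Set.Icc 0 L)
  velocity_sub : ∀ s ∈ Set.Icc 0 L, ∀ t ∈ Set.Icc 0 L, V t - V s = ∫ r in s..t, a r
  norm_velocity : ∀ t ∈ Set.Icc 0 L, ‖V t‖ = 1
  curve_sub : ∀ s ∈ Set.Icc 0 L, ∀ t ∈ Set.Icc 0 L, U t - U s = ∫ r in s..t, V r
  continuousOn_angle : ContinuousOn Θ (Set.Icc 0 L)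
  angle_sub : ∀ s ∈ Set.Icc 0 L, ∀ t ∈ Set.Icc 0 L, Θ t - Θ s = ∫ r in s..t, b r

/-- The average over the `i`-th cell of the grid of size `h`. -/
noncomputable def cellAverage {E : Type*} [NormedAddCommGroup E] [NormedSpace ℝ E] (F : ℝ → E)
    (h : ℝ) (i : ℕ) : E := h⁻¹ • ∫ t in ((i : ℝ) - 1) * h..i * h, F t

/-- The values on the grid. -/
def sampleVertices (U : ℝ → E3) (h : ℝ) (N : ℕ) (i : Fin (N + 1)) : E3 := U ((i : ℕ) * h)

/-- The averages over the cells of the grid. -/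
noncomputable def sampleAngles (Θ : ℝ → ℝ) (h : ℝ) (N : ℕ) (i : Fin N) : ℝ :=
  cellAverage Θ h (i + 1)

variable {L : ℝ} {a : L2 L E3} {b : L2 L ℝ} {V U : ℝ → E3} {Θ : ℝ → ℝ} {N : ℕ} {h : ℝ}

theorem vertex_sampleVertices {i : ℕ} (hi : i ≤ N) : vertex (sampleVertices U h N) i = U (i * h) := by
  rw [vertex, dif_pos (by omega), sampleVertices]

theorem angle_sampleAngles {i : ℕ} (h1 : 1 ≤ i) (h2 : i ≤ N) :
    angle (sampleAngles Θ h N) i = cellAverage Θ h i := by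
  rw [angle, dif_pos (by omega), sampleAngles]
  simp [Nat.sub_add_cancel h1]

theorem grid_mem (hh : 0 < h) (hNh : N * h = L) {x : ℝ} (h0 : 0 ≤ x) (h1 : x ≤ N) :
    x * h ∈ Set.Icc 0 L :=
  ⟨by positivity, by rw [← hNh]; gcongr⟩

theorem cell_subset (hh : 0 < h) (hNh : N * h = L) {i : ℕ} (h1 : 1 ≤ i) (h2 : i ≤ N) :
    ((i : ℝ) - 1) * h ∈ Set.Icc 0 L ∧ (i : ℝ) * h ∈ Set.Icc 0 L ∧ ((i : ℝ) - 1) * h ≤ i * h := by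
  have h1' : (1 : ℝ) ≤ i := by exact_mod_cast h1
  have h2' : (i : ℝ) ≤ N := by exact_mod_cast h2
  exact ⟨grid_mem hh hNh (by linarith) (by linarith), grid_mem hh hNh (by linarith) h2',
    by gcongr; linarith⟩

namespace Profile

theorem norm_curve_sub_le (P : Profile L a b V U Θ) {s t : ℝ} (hs : s ∈ Set.Icc 0 L)
    (ht : t ∈ Set.Icc 0 L) : ‖U t - U s‖ ≤ |t - s| := by
  rw [P.curve_sub s hs t ht]
  have := intervalIntegral.norm_integral_le_of_norm_le_const (a := s) (b := t) (f := V) (C := 1)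
    fun r hr => (P.norm_velocity r (Set.uIcc_subset_Icc hs ht (Set.uIoc_subset_uIcc hr))).le
  simpa using this

theorem edge_eq (P : Profile L a b V U Θ) (hh : 0 < h) (hNh : N * h = L) {i : ℕ} (h1 : 1 ≤ i)
    (h2 : i ≤ N) : vertex (sampleVertices U h N) i - vertex (sampleVertices U h N) (i - 1)
      = h • cellAverage V h i := by
  obtain ⟨m1, m2, -⟩ := cell_subset hh hNh h1 h2
  rw [vertex_sampleVertices h2, vertex_sampleVertices (by omega), cellAverage,
    smul_inv_smul₀ hh.ne', ← P.curve_sub _ m1 _ m2, Nat.cast_sub h1, Nat.cast_one]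

theorem edgeLength_eq (P : Profile L a b V U Θ) (hh : 0 < h) (hNh : N * h = L) {i : ℕ} (h1 : 1 ≤ i)
    (h2 : i ≤ N) : edgeLength (sampleVertices U h N) i = h * ‖cellAverage V h i‖ := by
  rw [edgeLength, P.edge_eq hh hNh h1 h2, norm_smul, Real.norm_of_nonneg hh.le]

theorem edgeDir_eq (P : Profile L a b V U Θ) (hh : 0 < h) (hNh : N * h = L) {i : ℕ} (h1 : 1 ≤ i)
    (h2 : i ≤ N) : edgeDir (sampleVertices U h N) i
      = ‖cellAverage V h i‖⁻¹ • cellAverage V h i := by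
  rw [edgeDir, P.edge_eq hh hNh h1 h2, P.edgeLength_eq hh hNh h1 h2, smul_smul, mul_inv,
    mul_comm h⁻¹, inv_mul_cancel_right₀ hh.ne']

theorem edgeLength_le (P : Profile L a b V U Θ) (hh : 0 < h) (hNh : N * h = L) {i : ℕ}
    (h1 : 1 ≤ i) (h2 : i ≤ N) : edgeLength (sampleVertices U h N) i ≤ h := by
  obtain ⟨m1, m2, -⟩ := cell_subset hh hNh h1 h2
  rw [edgeLength, vertex_sampleVertices h2, vertex_sampleVertices (by omega), Nat.cast_sub h1,
    Nat.cast_one]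
  refine (P.norm_curve_sub_le m1 m2).trans ?_
  rw [show (i : ℝ) * h - (i - 1) * h = h by ring, abs_of_pos hh]

open scoped InnerProductSpace in
-- Project the edge onto the initial velocity of its cell. Unit vectors satisfy ⟪V s, V t⟫ = 1 - ‖V
-- t - V s‖²/2, and the last term is at most hJ/2, with J the integral of ‖a‖² over the cell.
theorem le_edgeLength (P : Profile L a b V U Θ) (hh : 0 < h) (hNh : N * h = L) {i : ℕ}
    (h1 : 1 ≤ i) (h2 : i ≤ N) :
    h - h ^ 2 / 2 * ∫ t in ((i : ℝ) - 1) * h..i * h, ‖a t‖ ^ 2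
      ≤ edgeLength (sampleVertices U h N) i := by
  obtain ⟨m1, m2, hle⟩ := cell_subset hh hNh h1 h2
  set s := ((i : ℝ) - 1) * h with hs
  set r := (i : ℝ) * h with hr
  have hrs : r - s = h := by rw [hr, hs]; ring
  set J := ∫ t in s..r, ‖a t‖ ^ 2 with hJ
  have hsub : Set.uIcc s r ⊆ Set.Icc 0 L := Set.uIcc_subset_Icc m1 m2
  have hVi : IntervalIntegrable V volume s r :=
    (P.continuousOn_velocity.mono hsub).intervalIntegrable
  have hpt : ∀ t ∈ Set.Icc s r, 1 - h * J / 2 ≤ ⟪V s, V t⟫_ℝ := by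
    intro t ht
    have hmt : t ∈ Set.Icc 0 L := hsub (by rwa [Set.uIcc_of_le hle])
    have e1 : ‖V t - V s‖ ^ 2 ≤ h * J := by
      rw [P.velocity_sub s m1 t hmt]
      refine (sq_norm_intervalIntegral_le ht.1 (intervalIntegrable_of_Ioo (integrableOn_of_L2 a) m1
        hmt) (intervalIntegrable_of_Ioo (integrableOn_sq_norm a) m1 hmt)).trans ?_
      refine mul_le_mul (by linarith [ht.2]) ?_
        (intervalIntegral.integral_nonneg ht.1 fun _ _ => by positivity) hh.le
      exact intervalIntegral.integral_mono_interval le_rfl ht.1 ht.2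
        (ae_of_all _ fun t => by positivity)
        (intervalIntegrable_of_Ioo (integrableOn_sq_norm a) m1 m2)
    rw [norm_sub_sq_real, P.norm_velocity t hmt, P.norm_velocity s m1, real_inner_comm] at e1
    linarith
  have hint : h * (1 - h * J / 2) ≤ ⟪V s, ∫ t in s..r, V t⟫_ℝ := by
    have e : ⟪V s, ∫ t in s..r, V t⟫_ℝ = ∫ t in s..r, ⟪V s, V t⟫_ℝ :=
      ((innerSL ℝ (V s)).intervalIntegral_comp_comm hVi).symm
    rw [e]
    have := intervalIntegral.integral_mono_on (μ := volume) (f := fun _ => 1 - h * J / 2)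
      (g := fun t => ⟪V s, V t⟫_ℝ) hle (by simp)
      (((continuousOn_const.inner (P.continuousOn_velocity.mono hsub))).intervalIntegrable) hpt
    rwa [intervalIntegral.integral_const, hrs, smul_eq_mul] at this
  have hn := real_inner_le_norm (V s) (∫ t in s..r, V t)
  rw [P.norm_velocity s m1, one_mul] at hn
  have e : edgeLength (sampleVertices U h N) i = ‖∫ t in s..r, V t‖ := by
    rw [P.edgeLength_eq hh hNh h1 h2, cellAverage, norm_smul, norm_inv, Real.norm_of_nonneg hh.le,
      mul_inv_cancel_left₀ hh.ne']
  rw [e]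
  calc _ = h * (1 - h * J / 2) := by ring
    _ ≤ _ := hint.trans hn

theorem nearUniform (P : Profile L a b V U Θ) (hh : 0 < h) (hNh : N * h = L)
    (hδ : h * ‖a‖ ^ 2 ≤ 1) : NearUniform (sampleVertices U h N) h (h * ‖a‖ ^ 2 / 2) where
  pos := hh
  nonneg := by positivity
  le_half := by linarith
  lower i h1 h2 := by
    obtain ⟨m1, m2, hle⟩ := cell_subset hh hNh h1 h2
    refine le_trans ?_ (P.le_edgeLength hh hNh h1 h2)
    have := mul_le_mul_of_nonneg_left (intervalIntegral_sq_norm_le a m1 m2 hle)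
      (by positivity : 0 ≤ h ^ 2 / 2)
    calc _ = h - h ^ 2 / 2 * ‖a‖ ^ 2 := by ring
      _ ≤ _ := by linarith
  upper _ h1 h2 := P.edgeLength_le hh hNh h1 h2

/-- The local integrals of ‖a‖² add up to ‖a‖², so the total shortfall is O(h²). The uniform bound
in `nearUniform` would give only O(h), too weak for 1 ≤ α < 2. -/
theorem abs_stretch_sub_one_le (P : Profile L a b V U Θ) (hh : 0 < h) (hNh : N * h = L) :
    |stretch L (sampleVertices U h N) - 1| ≤ h ^ 2 / 2 * ‖a‖ ^ 2 / L := by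
  have hL := P.pos
  have up : polyLength (sampleVertices U h N) ≤ L := by
    have := Finset.sum_le_card_nsmul (Finset.Icc 1 N) (edgeLength (sampleVertices U h N)) h
      fun i hi => P.edgeLength_le hh hNh (Finset.mem_Icc.1 hi).1 (Finset.mem_Icc.1 hi).2
    rw [← hNh]
    simpa [polyLength] using this
  have lo : L - h ^ 2 / 2 * ‖a‖ ^ 2 ≤ polyLength (sampleVertices U h N) := by
    have h1 : ∑ i ∈ Finset.Icc 1 N, (h - h ^ 2 / 2 * ∫ t in ((i : ℝ) - 1) * h..i * h, ‖a t‖ ^ 2)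
        ≤ polyLength (sampleVertices U h N) := Finset.sum_le_sum fun i hi =>
      P.le_edgeLength hh hNh (Finset.mem_Icc.1 hi).1 (Finset.mem_Icc.1 hi).2
    have h2 : ∑ i ∈ Finset.Icc 1 N, ∫ t in ((i : ℝ) - 1) * h..i * h, ‖a t‖ ^ 2 = ‖a‖ ^ 2 := by
      have := intervalIntegral.sum_integral_adjacent_intervals (μ := volume) (n := N)
        (f := fun t => ‖a t‖ ^ 2) (a := fun i : ℕ => (i : ℝ) * h) fun k hk => by
          refine intervalIntegrable_of_Ioo (integrableOn_sq_norm a)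
            (grid_mem hh hNh (by positivity) (by exact_mod_cast hk.le))
            (grid_mem hh hNh (by positivity) (by exact_mod_cast hk))
      have e : Finset.Icc 1 N = Finset.Ico 1 (N + 1) := by ext; simp
      rw [e, Finset.sum_Ico_eq_sum_range, ← intervalIntegral_sq_norm hL.le]
      simp only [Nat.cast_zero, zero_mul, hNh] at this
      rw [← this]
      refine Finset.sum_congr rfl fun i _ => ?_
      rw [add_comm 1 i, Nat.cast_add_one, add_sub_cancel_right]
    rw [Finset.sum_sub_distrib, ← Finset.mul_sum, h2] at h1
    simpa [hNh] using h1
  rw [stretch, div_sub_one hL.ne', abs_div, abs_of_pos hL]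
  refine div_le_div_of_nonneg_right ?_ hL.le
  rw [abs_le]
  constructor
  · linarith
  · have : 0 ≤ h ^ 2 / 2 * ‖a‖ ^ 2 := by positivity
    linarith

theorem sum_sq_edgeDir_sub_le (P : Profile L a b V U Θ) (hN : 0 < N) (hh : 0 < h) (hNh : N * h = L)
    (hδ : h * ‖a‖ ^ 2 ≤ 1) :
    ∑ i ∈ Finset.Ico 1 N, ‖edgeDir (sampleVertices U h N) (i + 1)
      - edgeDir (sampleVertices U h N) i‖ ^ 2
      ≤ h * ‖a‖ ^ 2 / (1 - h * ‖a‖ ^ 2 / 2) ^ 2 := by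
  have hd : 0 < 1 - h * ‖a‖ ^ 2 / 2 := by linarith
  have hu := P.nearUniform hh hNh hδ
  have key := sum_sq_norm_sub_average_le a P.continuousOn_velocity
    (fun s hs t ht => P.velocity_sub s hs t ht) hN hh hNh (cellAverage V h) (fun _ _ => rfl)
  rw [le_div_iff₀ (by positivity), Finset.sum_mul]
  refine (Finset.sum_le_sum fun i hi => ?_).trans key
  rw [Finset.mem_Ico] at hi
  have low : ∀ j, 1 ≤ j → j ≤ N → 1 - h * ‖a‖ ^ 2 / 2 ≤ ‖cellAverage V h j‖ := fun j h1 h2 => by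
    have := hu.lower j h1 h2
    rw [P.edgeLength_eq hh hNh h1 h2] at this
    exact le_of_mul_le_mul_left this hh
  have l1 := low i hi.1 hi.2.le
  have l2 := low (i + 1) (by omega) hi.2
  rw [P.edgeDir_eq hh hNh (by omega) hi.2, P.edgeDir_eq hh hNh hi.1 hi.2.le]
  have n1 : cellAverage V h i ≠ 0 := norm_pos_iff.1 (hd.trans_le l1)
  have n2 : cellAverage V h (i + 1) ≠ 0 := norm_pos_iff.1 (hd.trans_le l2)
  have := sq_norm_normalize_sub_le n2 n1
  rw [le_div_iff₀ (mul_pos (norm_pos_iff.2 n2) (norm_pos_iff.2 n1))] at this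
  refine le_trans (mul_le_mul_of_nonneg_left ?_ (sq_nonneg _)) this
  rw [sq]
  exact mul_le_mul l2 l1 hd.le (norm_nonneg _)

/-- The exponent 4 collects two powers from cell lengths and stretch, and two from normalising the
averages. -/
theorem bendEnergy_le (P : Profile L a b V U Θ) (hN : 0 < N) (hh : 0 < h) (hNh : N * h = L)
    (hδ : h * ‖a‖ ^ 2 ≤ 1) : bendEnergy L (sampleVertices U h N) ≤ ENNReal.ofReal
      ((1 + 3 * (h * ‖a‖ ^ 2 / 2)) ^ 2 / (1 - h * ‖a‖ ^ 2 / 2) ^ 4 * ‖a‖ ^ 2) := by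
  refine ((P.nearUniform hh hNh hδ).bendEnergy_le hN P.pos hNh
    (P.sum_sq_edgeDir_sub_le hN hh hNh hδ)).trans (ENNReal.ofReal_le_ofReal (le_of_eq ?_))
  have hd : 1 - h * ‖a‖ ^ 2 / 2 ≠ 0 := by linarith
  generalize 1 - h * ‖a‖ ^ 2 / 2 = d at *
  field_simp

theorem torEnergy_le (P : Profile L a b V U Θ) (hN : 0 < N) (hh : 0 < h) (hNh : N * h = L)
    (hδ : h * ‖a‖ ^ 2 ≤ 1) : torEnergy L (sampleVertices U h N) (sampleAngles Θ h N)
      ≤ ENNReal.ofReal (1 / (1 - h * ‖a‖ ^ 2 / 2) ^ 2 * ‖b‖ ^ 2) := by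
  have key := sum_sq_norm_sub_average_le b P.continuousOn_angle
    (fun s hs t ht => P.angle_sub s hs t ht) hN hh hNh (cellAverage Θ h) (fun _ _ => rfl)
  refine ((P.nearUniform hh hNh hδ).torEnergy_le (S := h * ‖b‖ ^ 2) hN P.pos hNh
    (le_trans (le_of_eq ?_) key)).trans (ENNReal.ofReal_le_ofReal (le_of_eq ?_))
  · refine Finset.sum_congr rfl fun i hi => ?_
    rw [Finset.mem_Ico] at hi
    rw [angle_sampleAngles (by omega) hi.2, angle_sampleAngles hi.1 hi.2.le]
  · rw [mul_div_cancel_left₀ _ hh.ne']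

theorem penalty_le (P : Profile L a b V U Θ) (hN : 0 < N) (hh : 0 < h) (hNh : N * h = L)
    {α β : ℝ} : penalty L α β (sampleVertices U h N)
      ≤ (N : ℝ) ^ α * (h ^ 2 / 2 * ‖a‖ ^ 2 / L) + (N : ℝ) ^ β * h := by
  have : Nonempty (Fin N) := ⟨⟨0, hN⟩⟩
  refine add_le_add (mul_le_mul_of_nonneg_left (P.abs_stretch_sub_one_le hh hNh) (by positivity))
    (mul_le_mul_of_nonneg_left (ciSup_le fun i => P.edgeLength_le hh hNh (by omega) (by omega))
      (by positivity))

end Profile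

end KirchhoffRod

/-! ### Convergence of the sampled rods and the recovery sequence. -/

namespace KirchhoffRod

variable {L : ℝ} {a : L2 L E3} {b : L2 L ℝ} {V U : ℝ → E3} {Θ : ℝ → ℝ} {N : ℕ} {h : ℝ}

theorem NearUniform.norm_rodCurve_sub_le {X : Fin (N + 1) → E3} {δ : ℝ} (hu : NearUniform X h δ)
    (hX : IsRod X) (hL : 0 < L) (hh : N * h = L) {A : ℝ} (hA : ‖hX.accel hL‖ ≤ A) {s t : ℝ}
    (hs : s ∈ Set.Icc 0 L) (ht : t ∈ Set.Icc 0 L) :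
    ‖rodCurve L X t - rodCurve L X s‖ ≤ (1 + √(2 * h) * A) * |t - s| := by
  obtain ⟨sl, su⟩ := hu.stretch_bounds hL hh
  have hl := hX.stretch_pos hL
  have hpos := hu.pos
  rw [← intervalIntegral.integral_eq_sub_of_hasDerivAt (fun r _ => hX.hasDerivAt_rodCurve r)
    (hX.continuous_rodVelocity.intervalIntegrable _ _)]
  refine intervalIntegral.norm_integral_le_of_norm_le_const fun r hr => ?_
  have h1 := (abs_le.1 (hX.abs_norm_rodVelocity_sub_le hL
    (fun i hi => hu.upper i (Finset.mem_Icc.1 hi).1 (Finset.mem_Icc.1 hi).2)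
    (Set.uIcc_subset_Icc hs ht (Set.uIoc_subset_uIcc hr)))).2
  have h2 : h / stretch L X ≤ 2 * h := by
    rw [div_le_iff₀ hl]
    nlinarith [hu.le_half]
  have h3 := mul_le_mul (Real.sqrt_le_sqrt h2) hA (norm_nonneg _) (Real.sqrt_nonneg _)
  linarith

namespace Profile

theorem norm_angle_sub_le (P : Profile L a b V U Θ) {s t : ℝ} (hs : s ∈ Set.Icc 0 L)
    (ht : t ∈ Set.Icc 0 L) : ‖Θ t - Θ s‖ ≤ √|t - s| * ‖b‖ := by
  rw [P.angle_sub s hs t ht]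
  exact norm_intervalIntegral_le_sqrt b hs ht

/-- With δ = h‖a‖²/2 ≤ 1/2 the energy factor is at most (5/2)²/(1/2)⁴ = 10². -/
theorem norm_accel_le (P : Profile L a b V U Θ) (hN : 0 < N) (hh : 0 < h) (hNh : N * h = L)
    (hδ : h * ‖a‖ ^ 2 ≤ 1) (hX : IsRod (sampleVertices U h N)) :
    ‖hX.accel P.pos‖ ≤ 10 * ‖a‖ := by
  have hb := P.bendEnergy_le hN hh hNh hδ
  have hd : 1 / 2 ≤ 1 - h * ‖a‖ ^ 2 / 2 := by linarith
  have h0 : 0 ≤ h * ‖a‖ ^ 2 := by positivity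
  rw [hX.bendEnergy_eq_norm P.pos, ENNReal.ofReal_le_ofReal_iff (by positivity)] at hb
  refine abs_le_of_sq_le_sq' (hb.trans ?_) (by positivity) |>.2
  rw [mul_pow]
  refine mul_le_mul_of_nonneg_right ?_ (sq_nonneg _)
  rw [div_le_iff₀ (by positivity)]
  have h1 : (1 + 3 * (h * ‖a‖ ^ 2 / 2)) ^ 2 ≤ (5 / 2) ^ 2 :=
    pow_le_pow_left₀ (by positivity) (by linarith) 2
  have h2 : (1 / 2 : ℝ) ^ 4 ≤ (1 - h * ‖a‖ ^ 2 / 2) ^ 4 := pow_le_pow_left₀ (by norm_num) hd 4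
  linarith

theorem norm_slope_le (P : Profile L a b V U Θ) (hN : 0 < N) (hh : 0 < h) (hNh : N * h = L)
    (hδ : h * ‖a‖ ^ 2 ≤ 1) (hX : IsRod (sampleVertices U h N)) :
    ‖hX.slope P.pos (sampleAngles Θ h N)‖ ≤ 2 * ‖b‖ := by
  have hb := P.torEnergy_le hN hh hNh hδ
  have hd : 1 / 2 ≤ 1 - h * ‖a‖ ^ 2 / 2 := by linarith
  rw [hX.torEnergy_eq_norm P.pos, ENNReal.ofReal_le_ofReal_iff (by positivity)] at hb
  refine abs_le_of_sq_le_sq' (hb.trans ?_) (by positivity) |>.2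
  rw [mul_pow]
  refine mul_le_mul_of_nonneg_right ?_ (sq_nonneg _)
  rw [div_le_iff₀ (by positivity)]
  have h2 : (1 / 2 : ℝ) ^ 2 ≤ (1 - h * ‖a‖ ^ 2 / 2) ^ 2 := pow_le_pow_left₀ (by norm_num) hd 2
  linarith

/-- Pass through a nearby knot: there the spline is an edge midpoint, within h/2 of U(ih), and both
curves are Lipschitz. -/
theorem norm_rodCurve_sub_curve_le (P : Profile L a b V U Θ) (hN : 0 < N) (hh : 0 < h)
    (hNh : N * h = L) (hδ : h * ‖a‖ ^ 2 ≤ 1) {t : ℝ} (ht : t ∈ Set.Icc 0 L) :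
    ‖rodCurve L (sampleVertices U h N) t - U t‖ ≤ (1 + √(2 * h) * (10 * ‖a‖)) * (2 * h) + h / 2
      + (3 * h + 2 * L * (h * ‖a‖ ^ 2 / 2)) := by
  have hu := P.nearUniform hh hNh hδ
  have hX := hu.isRod hN
  obtain ⟨i, h1, h2, h3, h4⟩ := hu.exists_grid_near hN P.pos hNh ht
  have hk := hX.knot_div_mem P.pos h1 h2
  have e1 := hu.norm_rodCurve_sub_le hX P.pos hNh (P.norm_accel_le hN hh hNh hδ hX) hk ht
  rw [hX.rodCurve_knot P.pos h1 h2, hX.edgeMid_eq_right h1 h2, vertex_sampleVertices h2] at e1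
  have e2 : ‖(edgeLength (sampleVertices U h N) i / 2) • edgeDir (sampleVertices U h N) i‖
      ≤ h / 2 := by
    rw [norm_smul, hX.norm_edgeDir h1 h2, mul_one,
      Real.norm_of_nonneg (div_nonneg (edgeLength_nonneg _) (by norm_num))]
    linarith [hu.upper i h1 h2]
  have e3 := P.norm_curve_sub_le ht (cell_subset hh hNh h1 h2).2.1
  rw [abs_sub_comm] at e3
  have e4 := mul_le_mul_of_nonneg_left h3
    (by positivity : 0 ≤ 1 + √(2 * h) * (10 * ‖a‖))
  set m := (edgeLength (sampleVertices U h N) i / 2) • edgeDir (sampleVertices U h N) i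
  set y := rodCurve L (sampleVertices U h N) t
  calc ‖y - U t‖ = ‖(y - (U (i * h) - m)) + (-m) + (U (i * h) - U t)‖ := by congr 1; abel
    _ ≤ ‖y - (U (i * h) - m)‖ + ‖-m‖ + ‖U (i * h) - U t‖ := norm_add₃_le
    _ ≤ _ := by rw [norm_neg]; linarith

theorem norm_rodAngle_sub_angle_le (P : Profile L a b V U Θ) (hN : 0 < N) (hh : 0 < h)
    (hNh : N * h = L) (hδ : h * ‖a‖ ^ 2 ≤ 1) {t : ℝ} (ht : t ∈ Set.Icc 0 L) :
    ‖rodAngle L (sampleVertices U h N) (sampleAngles Θ h N) t - Θ t‖ ≤ √(2 * h) * (2 * ‖b‖)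
      + √(4 * h + 2 * L * (h * ‖a‖ ^ 2 / 2)) * ‖b‖ := by
  have hu := P.nearUniform hh hNh hδ
  have hX := hu.isRod hN
  obtain ⟨i, h1, h2, h3, h4⟩ := hu.exists_grid_near hN P.pos hNh ht
  have hk := hX.knot_div_mem P.pos h1 h2
  have e1 := hX.norm_rodAngle_sub_le (Φ := sampleAngles Θ h N) P.pos hk ht
  rw [hX.rodAngle_knot P.pos h1 h2, angle_sampleAngles h1 h2] at e1
  have e2 : √|t - knot (sampleVertices U h N) i / stretch L (sampleVertices U h N)|
      * ‖hX.slope P.pos (sampleAngles Θ h N)‖ ≤ √(2 * h) * (2 * ‖b‖) :=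
    mul_le_mul (Real.sqrt_le_sqrt h3) (P.norm_slope_le hN hh hNh hδ hX) (norm_nonneg _)
      (Real.sqrt_nonneg _)
  obtain ⟨m1, m2, hle⟩ := cell_subset hh hNh h1 h2
  have hlen : (i : ℝ) * h - (i - 1) * h = h := by ring
  have e3 : cellAverage Θ h i - Θ t = h⁻¹ • ∫ s in ((i : ℝ) - 1) * h..i * h, (Θ s - Θ t) := by
    rw [intervalIntegral.integral_sub
      ((P.continuousOn_angle.mono (Set.uIcc_subset_Icc m1 m2)).intervalIntegrable) (by simp),
      intervalIntegral.integral_const, hlen, smul_sub, inv_smul_smul₀ hh.ne', cellAverage]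
  -- The grid point ih is within 3h + 2Lδ of t, and the cell adds one more h.
  have e4 : ‖cellAverage Θ h i - Θ t‖ ≤ √(4 * h + 2 * L * (h * ‖a‖ ^ 2 / 2)) * ‖b‖ := by
    have := intervalIntegral.norm_integral_le_of_norm_le_const (a := ((i : ℝ) - 1) * h)
      (b := i * h) (f := fun s => Θ s - Θ t) (C := √(4 * h + 2 * L * (h * ‖a‖ ^ 2 / 2)) * ‖b‖)
      fun s hs => by
        have hm := Set.uIcc_subset_Icc m1 m2 (Set.uIoc_subset_uIcc hs)
        rw [Set.uIoc_of_le hle] at hs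
        refine (P.norm_angle_sub_le ht hm).trans
          (mul_le_mul_of_nonneg_right (Real.sqrt_le_sqrt ?_) (norm_nonneg _))
        rw [abs_le] at h4 ⊢
        constructor <;> linarith [hs.1, hs.2, h4.1, h4.2]
    rw [hlen, abs_of_pos hh] at this
    rw [e3, norm_smul, norm_inv, Real.norm_of_nonneg hh.le]
    calc _ ≤ h⁻¹ * (√(4 * h + 2 * L * (h * ‖a‖ ^ 2 / 2)) * ‖b‖ * h) :=
          mul_le_mul_of_nonneg_left this (by positivity)
      _ = _ := by field_simp
  calc _ = ‖(rodAngle L (sampleVertices U h N) (sampleAngles Θ h N) t - cellAverage Θ h i)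
        + (cellAverage Θ h i - Θ t)‖ := by congr 1; ring
    _ ≤ _ := norm_add_le _ _
    _ ≤ _ := by linarith

/-- Uniform errors become L² errors through the square root of the measure of the interval. The
explicit form lets all limits be taken by continuity at h = 0, apart from the penalty. -/
theorem exists_approximation (P : Profile L a b V U Θ) (hN : 0 < N) (hh : 0 < h)
    (hNh : N * h = L) (hδ : h * ‖a‖ ^ 2 ≤ 1) {p : L2 L E3 × L2 L ℝ}
    (h1 : p.1 =ᵐ[volume.restrict (Set.Ioo (0 : ℝ) L)] U)
    (h2 : p.2 =ᵐ[volume.restrict (Set.Ioo (0 : ℝ) L)] Θ) (α β : ℝ) :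
    ∃ q : L2 L E3 × L2 L ℝ,
      ‖q.1 - p.1‖ ≤ (volume.restrict (Set.Ioo (0 : ℝ) L)).real Set.univ ^ ((2 : ℝ≥0∞).toReal⁻¹)
        * ((1 + √(2 * h) * (10 * ‖a‖)) * (2 * h) + h / 2 + (3 * h + 2 * L * (h * ‖a‖ ^ 2 / 2))) ∧
      ‖q.2 - p.2‖ ≤ (volume.restrict (Set.Ioo (0 : ℝ) L)).real Set.univ ^ ((2 : ℝ≥0∞).toReal⁻¹)
        * (√(2 * h) * (2 * ‖b‖) + √(4 * h + 2 * L * (h * ‖a‖ ^ 2 / 2)) * ‖b‖) ∧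
      discreteEnergy L α β N q ≤ ENNReal.ofReal
          ((1 + 3 * (h * ‖a‖ ^ 2 / 2)) ^ 2 / (1 - h * ‖a‖ ^ 2 / 2) ^ 4 * ‖a‖ ^ 2)
        + ENNReal.ofReal (1 / (1 - h * ‖a‖ ^ 2 / 2) ^ 2 * ‖b‖ ^ 2)
        + ENNReal.ofReal ((N : ℝ) ^ α * (h ^ 2 / 2 * ‖a‖ ^ 2 / L) + (N : ℝ) ^ β * h) := by
  have hL := P.pos
  have hX := (P.nearUniform hh hNh hδ).isRod hN
  have c1 := memLp_of_continuous (L := L) (hX.continuous_rodCurve (L := L))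
  have c2 := memLp_of_continuous (L := L)
    (hX.continuous_rodAngle (L := L) (Φ := sampleAngles Θ h N))
  refine ⟨(c1.toLp _, c2.toLp _), ?_, ?_, ?_⟩
  · refine Lp.norm_le_of_ae_bound (by positivity) ?_
    filter_upwards [Lp.coeFn_sub (c1.toLp _) p.1, c1.coeFn_toLp, h1,
      ae_restrict_mem measurableSet_Ioo] with t e1 e2 e3 e4
    rw [e1, Pi.sub_apply, e2, e3]
    exact P.norm_rodCurve_sub_curve_le hN hh hNh hδ (Set.Ioo_subset_Icc_self e4)
  · refine Lp.norm_le_of_ae_bound (by positivity) ?_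
    filter_upwards [Lp.coeFn_sub (c2.toLp _) p.2, c2.coeFn_toLp, h2,
      ae_restrict_mem measurableSet_Ioo] with t e1 e2 e3 e4
    rw [e1, Pi.sub_apply, e2, e3]
    exact P.norm_rodAngle_sub_angle_le hN hh hNh hδ (Set.Ioo_subset_Icc_self e4)
  · have hrep : Represents L (sampleVertices U h N) (sampleAngles Θ h N)
        (c1.toLp _, c2.toLp _) := ⟨hX, c1.coeFn_toLp, c2.coeFn_toLp⟩
    refine le_trans (b := rodEnergy L α β (sampleVertices U h N) (sampleAngles Θ h N))
      (iInf₂_le_of_le _ _ (iInf_le _ hrep)) ?_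
    exact add_le_add (add_le_add (P.bendEnergy_le hN hh hNh hδ) (P.torEnergy_le hN hh hNh hδ))
      (ENNReal.ofReal_le_ofReal (P.penalty_le hN hh hNh))

end Profile

theorem primitive_sub {E : Type*} [NormedAddCommGroup E] [NormedSpace ℝ E] {g : ℝ → E}
    (hg : IntegrableOn g (Set.Ioo 0 L)) (c : E) {s t : ℝ} (hs : s ∈ Set.Icc 0 L)
    (ht : t ∈ Set.Icc 0 L) :
    (c + ∫ r in (0 : ℝ)..t, g r) - (c + ∫ r in (0 : ℝ)..s, g r) = ∫ r in s..t, g r := by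
  have h0 : (0 : ℝ) ∈ Set.Icc 0 L := ⟨le_rfl, hs.1.trans hs.2⟩
  rw [add_sub_add_left_eq_sub, intervalIntegral.integral_interval_sub_left
    (intervalIntegrable_of_Ioo hg h0 ht) (intervalIntegrable_of_Ioo hg h0 hs)]

/-- Pairs of finite energy are given by profiles. -/
theorem exists_profile (hL : 0 < L) {p : L2 L E3 × L2 L ℝ} (h1 : IsW22 p.1) (h2 : IsW12 p.2)
    (h3 : ∀ᵐ t ∂(volume.restrict (Set.Ioo (0 : ℝ) L)), ‖weakDeriv p.1 t‖ = 1) :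
    ∃ V U Θ, Profile L (weakDeriv (weakDeriv p.1)) (weakDeriv p.2) V U Θ ∧
      p.1 =ᵐ[volume.restrict (Set.Ioo (0 : ℝ) L)] U ∧
      p.2 =ᵐ[volume.restrict (Set.Ioo (0 : ℝ) L)] Θ := by
  set v := weakDeriv p.1 with hv
  set a := weakDeriv v with ha
  set b := weakDeriv p.2 with hb
  have w1 : HasWeakDeriv L p.1 v := h1.1.hasWeakDeriv
  have w2 : HasWeakDeriv L v a := h1.2.hasWeakDeriv
  have w3 : HasWeakDeriv L p.2 b := h2.hasWeakDeriv
  have ia := integrableOn_of_L2 a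
  have ib := integrableOn_of_L2 b
  obtain ⟨c1, e1⟩ := w2.exists_ae_eq_primitive hL (integrableOn_of_L2 v) ia
  obtain ⟨c2, e2⟩ := w3.exists_ae_eq_primitive hL (integrableOn_of_L2 p.2) ib
  set V : ℝ → E3 := fun t => c1 + ∫ s in (0 : ℝ)..t, a s with hV
  have hVc : ContinuousOn V (Set.Icc 0 L) := (continuousOn_primitive_Ioo hL.le ia).const_add c1
  have iV : IntegrableOn V (Set.Ioo 0 L) := hVc.integrableOn_Icc.mono_set Set.Ioo_subset_Icc_self
  obtain ⟨c3, e3⟩ := (w1.congr EventuallyEq.rfl e1).exists_ae_eq_primitive hL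
    (integrableOn_of_L2 p.1) iV
  refine ⟨V, _, _, ⟨hL, hVc, fun s hs t ht => primitive_sub ia c1 hs ht, ?_,
    fun s hs t ht => primitive_sub iV c3 hs ht, (continuousOn_primitive_Ioo hL.le ib).const_add c2,
    fun s hs t ht => primitive_sub ib c2 hs ht⟩, e3, e2⟩
  -- Continuity of the representative V upgrades unit speed from a.e. to everywhere on [0, L].
  have hae : (fun t => ‖V t‖) =ᵐ[volume.restrict (Set.Icc (0 : ℝ) L)] fun _ => (1 : ℝ) := by
    rw [← restrict_Ioo_eq_restrict_Icc]
    filter_upwards [e1, h3] with t ht ht'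
    rw [← ht, ht']
  exact Measure.eqOn_Icc_of_ae_eq volume hL.ne hae hVc.norm continuousOn_const

theorem tendsto_of_continuous_at_zero {f : ℝ → ℝ} (hf : ContinuousAt f 0) {c : ℝ} (hc : f 0 = c) :
    Tendsto (fun N : ℕ => f (L / N)) atTop (𝓝 c) := by
  rw [← hc]
  exact hf.tendsto.comp (tendsto_const_div_atTop_nhds_zero_nat L)

/-- The two terms are constants times N^(α-2) and N^(β-1). -/
theorem tendsto_penalty_bound {α β C : ℝ} (hα : α < 2) (hβ : β < 1) :
    Tendsto (fun N : ℕ => (N : ℝ) ^ α * ((L / N) ^ 2 / 2 * C / L) + (N : ℝ) ^ β * (L / N))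
      atTop (𝓝 0) := by
  have h1 := (tendsto_rpow_neg_atTop (sub_pos.2 hα)).comp tendsto_natCast_atTop_atTop
  have h2 := (tendsto_rpow_neg_atTop (sub_pos.2 hβ)).comp tendsto_natCast_atTop_atTop
  have h3 := (h1.const_mul (L ^ 2 / 2 * C / L)).add (h2.const_mul L)
  rw [mul_zero, mul_zero, add_zero] at h3
  refine h3.congr' ?_
  filter_upwards [eventually_gt_atTop 0] with N hN
  have hN' : (0 : ℝ) < N := by exact_mod_cast hN
  simp only [Function.comp, neg_sub]
  rw [Real.rpow_sub hN', Real.rpow_sub hN', Real.rpow_one, Real.rpow_two]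
  field_simp

theorem exists_recovery_sequence (hL : 0 < L) {α β : ℝ} (hα : α ∈ Set.Ioo (0 : ℝ) 2)
    (hβ : β ∈ Set.Ioo (0 : ℝ) 1) (p : L2 L E3 × L2 L ℝ) :
    ∃ q : ℕ → L2 L E3 × L2 L ℝ, Tendsto q atTop (𝓝 p) ∧
      Tendsto (fun N => discreteEnergy L α β N (q N)) atTop (𝓝 (kirchhoffEnergy L p)) := by
  have hlow := kirchhoffEnergy_le_liminf hL hα.1 hβ.1 p
  by_cases hp : IsW22 p.1 ∧ IsW12 p.2 ∧
      ∀ᵐ t ∂(volume.restrict (Set.Ioo (0 : ℝ) L)), ‖weakDeriv p.1 t‖ = 1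
  swap
  -- At infinite energy the liminf inequality for the constant sequence already forces divergence.
  · refine ⟨fun _ => p, tendsto_const_nhds, ?_⟩
    have := hlow _ tendsto_const_nhds
    rw [kirchhoffEnergy, if_neg hp] at this ⊢
    exact tendsto_of_le_liminf_of_limsup_le this le_top
  obtain ⟨V, U, Θ, P, e1, e2⟩ := exists_profile hL hp.1 hp.2.1 hp.2.2
  set a := weakDeriv (weakDeriv p.1)
  set b := weakDeriv p.2
  have hE : kirchhoffEnergy L p = ENNReal.ofReal (‖a‖ ^ 2) + ENNReal.ofReal (‖b‖ ^ 2) + 0 := by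
    rw [kirchhoffEnergy, if_pos hp,
      lintegral_add_left' ((Lp.aestronglyMeasurable a).enorm.pow_const 2),
      lintegral_enorm_sq, lintegral_enorm_sq, add_zero]
  have hsmall : ∀ᶠ N : ℕ in atTop, 0 < N ∧ L / N * ‖a‖ ^ 2 ≤ 1 := by
    refine (eventually_gt_atTop 0).and (Tendsto.eventually_le_const zero_lt_one ?_)
    exact tendsto_of_continuous_at_zero (f := fun h => h * ‖a‖ ^ 2) (by fun_prop) (by simp)
  have hex := fun (N : ℕ) (hN : 0 < N ∧ L / N * ‖a‖ ^ 2 ≤ 1) =>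
    have hN' : (0 : ℝ) < N := Nat.cast_pos.2 hN.1
    P.exists_approximation hN.1 (div_pos hL hN') (mul_div_cancel₀ L hN'.ne') hN.2 e1 e2 α β
  -- For the finitely many N that are too small, q takes an arbitrary value; all later claims are
  -- eventual.
  choose! q hq using hex
  have hqp : Tendsto q atTop (𝓝 p) := by
    refine Prod.tendsto_iff _ _ |>.2 ⟨?_, ?_⟩
    · refine tendsto_iff_norm_sub_tendsto_zero.2 (squeeze_zero' (Eventually.of_forall fun _ =>
        norm_nonneg _) (hsmall.mono fun N hN => (hq N hN).1) ?_)
      refine tendsto_of_continuous_at_zero (f := fun h => _ * ((1 + √(2 * h) * (10 * ‖a‖)) * (2 * h)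
        + h / 2 + (3 * h + 2 * L * (h * ‖a‖ ^ 2 / 2)))) (by fun_prop) (by simp)
    · refine tendsto_iff_norm_sub_tendsto_zero.2 (squeeze_zero' (Eventually.of_forall fun _ =>
        norm_nonneg _) (hsmall.mono fun N hN => (hq N hN).2.1) ?_)
      refine tendsto_of_continuous_at_zero (f := fun h => _ * (√(2 * h) * (2 * ‖b‖)
        + √(4 * h + 2 * L * (h * ‖a‖ ^ 2 / 2)) * ‖b‖)) (by fun_prop) (by simp)
  refine ⟨q, hqp, tendsto_of_le_liminf_of_limsup_le (hlow q hqp) ?_⟩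
  refine (limsup_le_limsup (hsmall.mono fun N hN => (hq N hN).2.2)).trans (le_of_eq ?_)
  refine Tendsto.limsup_eq ?_
  rw [hE]
  refine ((ENNReal.tendsto_ofReal ?_).add (ENNReal.tendsto_ofReal ?_)).add ?_
  · exact tendsto_of_continuous_at_zero (f := fun h => (1 + 3 * (h * ‖a‖ ^ 2 / 2)) ^ 2
      / (1 - h * ‖a‖ ^ 2 / 2) ^ 4 * ‖a‖ ^ 2) (by
        refine ContinuousAt.mul (ContinuousAt.div (by fun_prop) (by fun_prop) (by simp))
          (by fun_prop)) (by simp)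
  · exact tendsto_of_continuous_at_zero (f := fun h => 1 / (1 - h * ‖a‖ ^ 2 / 2) ^ 2 * ‖b‖ ^ 2) (by
        refine ContinuousAt.mul (ContinuousAt.div (by fun_prop) (by fun_prop) (by simp))
          (by fun_prop)) (by simp)
  · simpa using ENNReal.tendsto_ofReal (tendsto_penalty_bound (L := L) (C := ‖a‖ ^ 2) hα.2 hβ.2)

end KirchhoffRod

theorem theorem2p4 (L α β : ℝ) (hL : 0 < L) (hα : α ∈ Set.Ioo (0 : ℝ) 2)
    (hβ : β ∈ Set.Ioo (0 : ℝ) 1) :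
    KirchhoffRod.GammaConverges (KirchhoffRod.discreteEnergy L α β)
      (KirchhoffRod.kirchhoffEnergy L) where
  liminf_ineq p q hq := KirchhoffRod.kirchhoffEnergy_le_liminf hL hα.1 hβ.1 p q hq
  recovery p := KirchhoffRod.exists_recovery_sequence hL hα hβ p
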